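/- Write $\lg=\log_2$. A *basis* of a finite abelian group $G$ is a vector $(\alpha_1,\ldots,\alpha_k)$ of elements of $G$ such that every $\beta\in G$ can be written uniquely as $\beta=\alpha_1^{x_1}\cdots\alpha_k^{x_k}$ with integers $0\le x_i<|\alpha_i|$. A (deterministic) *generic algorithm* accesses $G$ only through a black box: every group element is represented by an arbitrarily assigned unique identifier, the algorithm is given the identifier of the identity element, and the black box returns, for elements whose identifiers are already known to the algorithm, the identifier of a product or of an inverse; each such call counts as one group operation, and all other (effective) computation is free. For a finite abelian $p$-group $G$ of exponent $p^m$ with basis $(\alpha_1,\ldots,\alpha_k)$, let $n_i=\log_p|\alpha_i|$, let $r_j$ be the rank of the subgroup of $p^j$-th powers in $G$, and let $$T_{\rm DL}(G)=\sum_{i:\,\alpha_i\neq 1}\frac{\lg(n_i+1)}{\lg\lg(n_i+2)}\lg|\alpha_i|+\sum_{j=0}^{m-1}p^{r_j/2}$$ (the bound, up to an absolute constant factor, for the number of group operations used to compute a discrete logarithm in $G$ with respect to a given basis; it does not depend on the choice of the basis). There is a deterministic generic algorithm which, given a prime $p$ and a list $S$ of elements generating a finite abelian $p$-group $G$ of rank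 $r$ with $|S|=r+O(1)$, computes a basis of $G$ using $$O\left(\lg^{2+\epsilon}|G|\right)+O\left(T_{\rm DL}(G)\right)=O\left(|G|^{1/2}\right)$$ group operations. Precisely: one algorithm works for all $p$, $G$, $S$ and all assignments of identifiers, without being given $r$ or $|G|$, and for every $t\ge 0$ there is a constant $c>0$ such that for every $\epsilon>0$ there are constants $C,C'>0$ with the property that, whenever $|S|\le r+t$, the algorithm outputs a basis of $G$ after at most $$C\lg^{2+\epsilon}|G|+c\,T_{\rm DL}(G)\le C'|G|^{1/2}$$ group operations. -/

import Mathlib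

/-- What a generic algorithm sees at a given moment: the prime `p`, the identifier of the identity
element, the identifiers of the given generators, and the identifiers that the black box has
returned so far, in chronological order. -/
abbrev GenericView : Type := ℕ × ℕ × List ℕ × List ℕ

/-- What a generic algorithm may do next: ask the black box to multiply the elements with two given
identifiers (`Sum.inl (a, b)`), ask it to invert the element with a given identifier
(`Sum.inr (Sum.inl a)`), or halt and output a list of identifiers (`Sum.inr (Sum.inr l)`). -/
abbrev GenericRequest : Type := (ℕ × ℕ) ⊕ (ℕ ⊕ List ℕ)

/-- A deterministic generic algorithm: an effective (partial recursive) rule that determines the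
next request from what the algorithm has seen so far. All computation between two requests is
free; only calls of the black box are counted. -/
structure GenericAlgorithm where
  next : GenericView →. GenericRequest
  effective : Partrec next

namespace GenericAlgorithm

/-- The view of the algorithm when the black box uses the identifiers `enc`, the given elements are
`S`, and the elements returned by the black box so far are `ans`. -/
def view {G : Type*} [Group G] (p : ℕ) (enc : G ↪ ℕ) (S ans : List G) : GenericView :=
  (p, enc 1, S.map enc, ans.map enc)

/-- The group elements whose identifiers are available to the algorithm. -/
def known {G : Type*} [Group G] (S ans : List G) : List G := 1 :: (S ++ ans)

/-- `A.Run p enc S ans k out`: starting from the moment when the black box has returned (the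
identifiers of) `ans`, the algorithm `A` with input `p` and `S` makes exactly `k` further calls of
the black box (multiplications and inversions) and then halts with output (the identifiers of)
`out`. Only elements whose identifiers were given or returned before may be used. -/
inductive Run {G : Type*} [Group G] (A : GenericAlgorithm) (p : ℕ) (enc : G ↪ ℕ) (S : List G) :
    List G → ℕ → List G → Prop
  | halt (ans out : List G) (hout : ∀ g ∈ out, g ∈ known S ans)
      (hreq : Sum.inr (Sum.inr (out.map enc)) ∈ A.next (view p enc S ans)) :
      Run A p enc S ans 0 out
  | mul (ans : List G) (g h : G) (k : ℕ) (out : List G)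
      (hg : g ∈ known S ans) (hh : h ∈ known S ans)
      (hreq : Sum.inl (enc g, enc h) ∈ A.next (view p enc S ans))
      (hrun : Run A p enc S (ans ++ [g * h]) k out) :
      Run A p enc S ans (k + 1) out
  | inv (ans : List G) (g : G) (k : ℕ) (out : List G)
      (hg : g ∈ known S ans)
      (hreq : Sum.inr (Sum.inl (enc g)) ∈ A.next (view p enc S ans))
      (hrun : Run A p enc S (ans ++ [g⁻¹]) k out) :
      Run A p enc S ans (k + 1) out

end GenericAlgorithm

/-- The vector `α` is a basis of `G`: every element of `G` is uniquely of the form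
`α₁ ^ x₁ ⋯ αₖ ^ xₖ` with `0 ≤ xᵢ < |αᵢ|`. -/
def IsGroupBasis {G : Type*} [CommGroup G] (α : List G) : Prop :=
  ∀ β : G, ∃! x : Fin α.length → ℕ,
    (∀ i, x i < orderOf (α.get i)) ∧ ∏ i, α.get i ^ x i = β

/-- The rank (minimal number of generators) of the subgroup of `p ^ j`-th powers in `G`. -/
noncomputable def powRank (p : ℕ) (G : Type*) [CommGroup G] [Finite G] (j : ℕ) : ℕ :=
  Group.rank (powMonoidHom (p ^ j) : G →* G).range

/-- The discrete logarithm cost `T_DL(G)` of a finite abelian `p`-group `G` of exponent `p ^ m`,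
read off from a basis `α` of `G` (it does not depend on which one): with `|αᵢ| = p ^ nᵢ` and `r_j`
the rank of the subgroup of `p ^ j`-th powers, it is
`∑ᵢ (lg (nᵢ + 1) / lg lg (nᵢ + 2)) * lg |αᵢ| + ∑_{j < m} p ^ (r_j / 2)`. -/
noncomputable def dlCost (p : ℕ) {G : Type*} [CommGroup G] [Finite G] (α : List G) : ℝ :=
  (α.map fun a =>
      Real.logb 2 ((Nat.log p (orderOf a) : ℝ) + 1) /
          Real.logb 2 (Real.logb 2 ((Nat.log p (orderOf a) : ℝ) + 2)) *
        Real.logb 2 (orderOf a : ℝ)).sum +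
    ∑ j ∈ Finset.range (Nat.log p (Monoid.exponent G)), (p : ℝ) ^ ((powRank p G j : ℝ) / 2)

/-! # A generic algorithm for bases of finite abelian `p`-groups

The algorithm keeps an independent family `P` and a list of further generators. By decreasing order
of the generators `u`, it decides with baby steps and giant steps whether the element of order `p`
in `⟨u⟩` belongs to the span of those of `P`. If not, `u` is added to `P`; otherwise `u` is
multiplied with an element of `⟨P⟩` such that its order drops. -/

-- Call the element of order `p` in a nontrivial cyclic group `⟨g⟩` the top of `g`. A family `P`
-- whose tops are linearly independent over the field with `p` elements is itself independent
-- (`pow_eq_one_of_prod_eq_one`). Together with `P`, further elements are kept, `n = |S|` in all,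
-- that always generate `G`. Let `u` be one of these further elements of maximal order `p ^ a`; all
-- orders in `P` are at least `p ^ a`. If the top of `u` is not in the span of the tops of `P`, then
-- `u` joins `P`. Otherwise the relation between tops yields a product `h` of powers of elements of
-- `P` with `(u * h) ^ p ^ (a - 1) = 1`, and `u * h` replaces `u`. When only trivial elements are
-- left outside `P`, it is a basis (`isGroupBasis_of_indep`).
--
-- Relations in dimension `v = |P|` are found by baby steps and giant steps. About `(n + 1 - v) * p
-- ^ (v / 2)` baby steps are stored each time `P` grows, so a search costs only `O(p ^ (v / 2) / (n
-- + 1 - v))`. The number of elements of height greater than `j` starts at most at `n`, never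
-- increases, and is always at least `r_j` (`powRank_le_countP`). Hence at most `n - r_j` reductions
-- happen at height `j + 1`, where `v ≤ r_j` (`length_le_powRank`), and their searches cost `O(p ^
-- (r_j / 2))` up to lower-order terms. The tables for `v = 1, …, r` form an essentially geometric
-- sum, `O((t + 1) * p ^ (r / 2))`, absorbed by the term `j = 0` of `T_DL`. This amortization is the
-- `potential` carried by `Invariant`.
--
-- The remaining operations number `O((r + t) ^ 2 * lg ^ 2 |G|)`. This is at most `C * lg ^ (2 + ε)
-- |G| + √2 ^ r` (`exists_poly_mul_sq_le`), and `√2 ^ r ≤ p ^ (r / 2)`, so `ε` affects only `C`.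
-- Finally `p ^ (∑ r_j) ≤ |G|` bounds everything by `|G| ^ (1 / 2)`.
--
-- As a black-box machine, the algorithm keeps no memory between requests: `nextRequest` replays the
-- program `basis` on all answers received so far.

attribute [fun_prop] Primrec Primrec.comp Primrec.const Primrec.id

namespace BasisAlgorithm

/-! ### Closure properties of primitive recursive functions -/

section PrimrecRules

variable {σ α β γ : Type*} [Primcodable σ] [Primcodable α] [Primcodable β] [Primcodable γ]

@[fun_prop]
theorem primrec_prodMk {f : σ → α} {g : σ → β} (hf : Primrec f) (hg : Primrec g) :
    Primrec fun s => (f s, g s) :=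
  hf.pair hg

@[fun_prop]
theorem primrec_fst {f : σ → α × β} (hf : Primrec f) : Primrec fun s => (f s).1 :=
  Primrec.fst.comp hf

@[fun_prop]
theorem primrec_snd {f : σ → α × β} (hf : Primrec f) : Primrec fun s => (f s).2 :=
  Primrec.snd.comp hf

@[fun_prop]
theorem primrec_add {f g : σ → ℕ} (hf : Primrec f) (hg : Primrec g) :
    Primrec fun s => f s + g s :=
  Primrec.nat_add.comp hf hg

@[fun_prop]
theorem primrec_mul {f g : σ → ℕ} (hf : Primrec f) (hg : Primrec g) :
    Primrec fun s => f s * g s :=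
  Primrec.nat_mul.comp hf hg

@[fun_prop]
theorem primrec_sub {f g : σ → ℕ} (hf : Primrec f) (hg : Primrec g) :
    Primrec fun s => f s - g s :=
  Primrec.nat_sub.comp hf hg

@[fun_prop]
theorem primrec_div {f g : σ → ℕ} (hf : Primrec f) (hg : Primrec g) :
    Primrec fun s => f s / g s :=
  Primrec.nat_div.comp hf hg

@[fun_prop]
theorem primrec_mod {f g : σ → ℕ} (hf : Primrec f) (hg : Primrec g) :
    Primrec fun s => f s % g s :=
  Primrec.nat_mod.comp hf hg

@[fun_prop]
theorem primrec_min {f g : σ → ℕ} (hf : Primrec f) (hg : Primrec g) :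
    Primrec fun s => min (f s) (g s) :=
  Primrec.nat_min.comp hf hg

@[fun_prop]
theorem primrec_max {f g : σ → ℕ} (hf : Primrec f) (hg : Primrec g) :
    Primrec fun s => max (f s) (g s) :=
  Primrec.nat_max.comp hf hg

@[fun_prop]
theorem primrec_pow {f g : σ → ℕ} (hf : Primrec f) (hg : Primrec g) :
    Primrec fun s => f s ^ g s :=
  (Primrec₂.unpaired'.1 Nat.Primrec.pow : Primrec₂ fun a b : ℕ => a ^ b).comp hf hg

@[fun_prop]
theorem primrec_sqrt {f : σ → ℕ} (hf : Primrec f) : Primrec fun s => Nat.sqrt (f s) :=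
  Nat.Primrec'.prim_iff₁.1 Nat.Primrec'.sqrt |>.comp hf

@[fun_prop]
theorem primrec_ite {a b : σ → ℕ} {f g : σ → α} (ha : Primrec a) (hb : Primrec b)
    (hf : Primrec f) (hg : Primrec g) : Primrec fun s => if a s = b s then f s else g s :=
  Primrec.ite (Primrec.eq.comp ha hb) hf hg

@[fun_prop]
theorem primrec_cons {f : σ → α} {g : σ → List α} (hf : Primrec f) (hg : Primrec g) :
    Primrec fun s => f s :: g s :=
  Primrec.list_cons.comp hf hg

@[fun_prop]
theorem primrec_append {f g : σ → List α} (hf : Primrec f) (hg : Primrec g) :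
    Primrec fun s => f s ++ g s :=
  Primrec.list_append.comp hf hg

@[fun_prop]
theorem primrec_length {f : σ → List α} (hf : Primrec f) : Primrec fun s => (f s).length :=
  Primrec.list_length.comp hf

@[fun_prop]
theorem primrec_reverse {f : σ → List α} (hf : Primrec f) : Primrec fun s => (f s).reverse :=
  Primrec.list_reverse.comp hf

@[fun_prop]
theorem primrec_flatten {f : σ → List (List α)} (hf : Primrec f) :
    Primrec fun s => (f s).flatten :=
  Primrec.list_flatten.comp hf

@[fun_prop]
theorem primrec_range {f : σ → ℕ} (hf : Primrec f) : Primrec fun s => List.range (f s) :=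
  Primrec.list_range.comp hf

@[fun_prop]
theorem primrec_tail {f : σ → List α} (hf : Primrec f) : Primrec fun s => (f s).tail :=
  Primrec.list_tail.comp hf

@[fun_prop]
theorem primrec_headI [Inhabited α] {f : σ → List α} (hf : Primrec f) :
    Primrec fun s => (f s).headI :=
  Primrec.list_headI.comp hf

@[fun_prop]
theorem primrec_head? {f : σ → List α} (hf : Primrec f) :
    Primrec fun s => (f s).head? :=
  Primrec.list_head?.comp hf

@[fun_prop]
theorem primrec_getD {f : σ → List α} {g : σ → ℕ} {d : σ → α} (hf : Primrec f)
    (hg : Primrec g) (hd : Primrec d) : Primrec fun s => (f s).getD (g s) (d s) := by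
  simp only [List.getD_eq_getElem?_getD]
  exact Primrec.option_getD.comp (Primrec.list_getElem?.comp hf hg) hd

@[fun_prop]
theorem primrec_map {f : σ → List α} {g : σ → α → β} (hf : Primrec f)
    (hg : Primrec fun c : σ × α => g c.1 c.2) : Primrec fun s => (f s).map (g s) :=
  Primrec.list_map hf hg

@[fun_prop]
theorem primrec_flatMap {f : σ → List α} {g : σ → α → List β} (hf : Primrec f)
    (hg : Primrec fun c : σ × α => g c.1 c.2) : Primrec fun s => (f s).flatMap (g s) :=
  Primrec.list_flatMap hf hg

end PrimrecRules

/-! ### Programs over the black box and the basis algorithm -/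

section Programs

/-- A generic program: given the answers of the black box that are still unread, it either asks for
the product of two elements or returns a value together with the answers it has not used. -/
def Prog (α : Type*) : Type _ := List ℕ → (ℕ × ℕ) ⊕ (α × List ℕ)

variable {σ α β γ : Type*}

/-- Return a value without calling the black box. -/
def Prog.ret (x : α) : Prog α := fun l => Sum.inr (x, l)

/-- Multiply two elements. -/
def Prog.mul (a b : ℕ) : Prog ℕ :=
  fun l => (l.head?).elim (Sum.inl (a, b)) fun c => Sum.inr (c, l.tail)

/-- Run a program and then another one that depends on its value. -/
def Prog.bind (q : Prog α) (f : α → Prog β) : Prog β :=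
  fun l => Sum.elim Sum.inl (fun r => f r.1 r.2) (q l)

/-- Choose between two programs. -/
def Prog.ifEq (a b : ℕ) (q r : Prog α) : Prog α := fun l => if a = b then q l else r l

/-- Case distinction on an optional value. -/
def Prog.cases (o : Option β) (q : Prog α) (f : β → Prog α) : Prog α :=
  fun l => o.elim (q l) fun x => f x l

/-- Loop over a list. -/
def Prog.fold (L : List β) (x : α) (f : α → β → Prog α) : Prog α :=
  fun l => L.foldl (fun r b => Sum.elim Sum.inl (fun r => f r.1 b r.2) r) (Sum.inr (x, l))

/-- Iterate a step; the number of repetitions exceeds the number of unread answers. -/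
def Prog.iter (x : α) (f : α → Prog α) : Prog α :=
  fun l => Prog.fold (0 :: l) x (fun x _ => f x) l

/-- Collect the values of a program over a list. -/
def Prog.collect (L : List β) (f : β → Prog (List α)) : Prog (List α) :=
  Prog.fold L [] fun acc b => (f b).bind fun r => Prog.ret (acc ++ r)

section Rules

variable [Primcodable σ] [Primcodable α] [Primcodable β] [Primcodable γ]

@[fun_prop]
theorem primrec_ret {x : σ → α} {l : σ → List ℕ} (hx : Primrec x) (hl : Primrec l) :
    Primrec fun s => Prog.ret (x s) (l s) :=
  Primrec.sumInr.comp (hx.pair hl)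

@[fun_prop]
theorem primrec_progMul {a b : σ → ℕ} {l : σ → List ℕ} (ha : Primrec a) (hb : Primrec b)
    (hl : Primrec l) : Primrec fun s => Prog.mul (a s) (b s) (l s) := by
  have h := Primrec.option_casesOn (o := fun s => (l s).head?)
    (f := fun s => (Sum.inl (a s, b s) : (ℕ × ℕ) ⊕ (ℕ × List ℕ)))
    (g := fun s c => Sum.inr (c, (l s).tail)) (by fun_prop)
    (Primrec.sumInl.comp (by fun_prop)) (Primrec.sumInr.comp (by fun_prop))
  refine h.of_eq fun s => ?_
  unfold Prog.mul
  cases (l s).head? <;> rfl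

theorem primrec_sumElim {r : σ → (ℕ × ℕ) ⊕ (α × List ℕ)}
    {g : σ → α × List ℕ → (ℕ × ℕ) ⊕ (β × List ℕ)} (hr : Primrec r)
    (hg : Primrec fun c : σ × (α × List ℕ) => g c.1 c.2) :
    Primrec fun s => Sum.elim Sum.inl (g s) (r s) := by
  have h := Primrec.sumCasesOn (g := fun (_ : σ) (x : ℕ × ℕ) =>
    (Sum.inl x : (ℕ × ℕ) ⊕ (β × List ℕ))) (h := g) hr (Primrec.sumInl.comp Primrec.snd) hg
  refine h.of_eq fun s => ?_
  cases r s <;> rfl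

@[fun_prop]
theorem primrec_bind {q : σ → Prog α} {f : σ → α → Prog β} {l : σ → List ℕ}
    (hq : Primrec fun s => q s (l s))
    (hf : Primrec fun c : σ × (α × List ℕ) => f c.1 c.2.1 c.2.2) :
    Primrec fun s => Prog.bind (q s) (f s) (l s) :=
  primrec_sumElim (g := fun s r => f s r.1 r.2) hq hf

@[fun_prop]
theorem primrec_ifEq {a b : σ → ℕ} {q r : σ → Prog α} {l : σ → List ℕ} (ha : Primrec a)
    (hb : Primrec b) (hq : Primrec fun s => q s (l s)) (hr : Primrec fun s => r s (l s)) :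
    Primrec fun s => Prog.ifEq (a s) (b s) (q s) (r s) (l s) :=
  primrec_ite ha hb hq hr

@[fun_prop]
theorem primrec_cases {o : σ → Option β} {q : σ → Prog α} {f : σ → β → Prog α} {l : σ → List ℕ}
    (ho : Primrec o) (hq : Primrec fun s => q s (l s))
    (hf : Primrec fun c : σ × β => f c.1 c.2 (l c.1)) :
    Primrec fun s => Prog.cases (o s) (q s) (f s) (l s) := by
  refine (Primrec.option_casesOn (g := fun s x => f s x (l s)) ho hq hf).of_eq fun s => ?_
  unfold Prog.cases
  cases o s <;> rfl

@[fun_prop]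
theorem primrec_fold {L : σ → List β} {x : σ → α} {f : σ → α → β → Prog α} {l : σ → List ℕ}
    (hL : Primrec L) (hx : Primrec x) (hl : Primrec l)
    (hf : Primrec fun c : σ × (α × β × List ℕ) => f c.1 c.2.1 c.2.2.1 c.2.2.2) :
    Primrec fun s => Prog.fold (L s) (x s) (f s) (l s) := by
  refine Primrec.list_foldl (h := fun s (c : ((ℕ × ℕ) ⊕ (α × List ℕ)) × β) =>
    Sum.elim Sum.inl (fun r => f s r.1 c.2 r.2) c.1) hL
    (Primrec.sumInr.comp (hx.pair hl)) ?_
  exact primrec_sumElim (σ := σ × (((ℕ × ℕ) ⊕ (α × List ℕ)) × β)) (r := fun c => c.2.1)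
    (g := fun c r => f c.1 r.1 c.2.2 r.2)
    (by fun_prop) (hf.comp (f := fun c : σ × (α × β × List ℕ) => f c.1 c.2.1 c.2.2.1 c.2.2.2)
      (g := fun c : (σ × (((ℕ × ℕ) ⊕ (α × List ℕ)) × β)) × (α × List ℕ) =>
        (c.1.1, c.2.1, c.1.2.2, c.2.2)) (by fun_prop))

@[fun_prop]
theorem primrec_iter {x : σ → α} {f : σ → α → Prog α} {l : σ → List ℕ}
    (hx : Primrec x) (hl : Primrec l)
    (hf : Primrec fun c : σ × (α × List ℕ) => f c.1 c.2.1 c.2.2) :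
    Primrec fun s => Prog.iter (x s) (f s) (l s) :=
  primrec_fold (β := ℕ) (f := fun s x _ => f s x) (by fun_prop) hx hl
    (hf.comp (f := fun c : σ × (α × List ℕ) => f c.1 c.2.1 c.2.2)
      (g := fun c : σ × (α × ℕ × List ℕ) => (c.1, c.2.1, c.2.2.2)) (by fun_prop))

@[fun_prop]
theorem primrec_collect {L : σ → List β} {f : σ → β → Prog (List α)} {l : σ → List ℕ}
    (hL : Primrec L) (hl : Primrec l)
    (hf : Primrec fun c : σ × (β × List ℕ) => f c.1 c.2.1 c.2.2) :
    Primrec fun s => Prog.collect (L s) (f s) (l s) := by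
  refine primrec_fold (f := fun s acc b => (f s b).bind fun r => Prog.ret (acc ++ r))
    hL (by fun_prop) hl ?_
  refine primrec_bind (σ := σ × (List α × β × List ℕ)) (q := fun c => f c.1 c.2.2.1)
    (f := fun c r => Prog.ret (c.2.1 ++ r)) (l := fun c => c.2.2.2) ?_ (by fun_prop)
  exact hf.comp (f := fun c : σ × (β × List ℕ) => f c.1 c.2.1 c.2.2)
    (g := fun c : σ × (List α × β × List ℕ) => (c.1, c.2.2.1, c.2.2.2)) (by fun_prop)

end Rules

/-- The power `g ^ x`, by repeated squaring; `e` is the identity. -/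
def power (e g x : ℕ) : Prog ℕ :=
  (Prog.fold (List.range x) (e, g, x) fun s _ =>
    Prog.ifEq s.2.2 0 (Prog.ret s) <|
      (Prog.mul s.1 (if s.2.2 % 2 = 1 then s.2.1 else e)).bind fun a =>
        (Prog.mul s.2.1 s.2.1).bind fun b => Prog.ret (a, b, s.2.2 / 2)).bind
  fun s => Prog.ret s.1

/-- The powers `g, g ^ p, g ^ p ^ 2, …` that are not the identity `e`. -/
def chain (p e g : ℕ) : Prog (List ℕ) :=
  (Prog.iter (([] : List ℕ), g) fun s =>
    Prog.ifEq s.2 e (Prog.ret s) <|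
      (power e s.2 p).bind fun h => Prog.ret (s.1 ++ [s.2], h)).bind
  fun s => Prog.ret s.1

/-- Multiply the entries of a table with the powers `w ^ c` for `c < q`, and record the exponent
`c * inc`. -/
def extend (T : List (ℕ × List ℕ)) (w q inc : ℕ) : Prog (List (ℕ × List ℕ)) :=
  Prog.collect T fun t =>
    (Prog.fold (List.range (q - 1)) ([(t.1, 0 :: t.2)], t.1) fun s c =>
      (Prog.mul s.2 w).bind fun h => Prog.ret (s.1 ++ [(h, ((c + 1) * inc) :: t.2)], h)).bind
    fun s => Prog.ret s.1

/-- The tables of baby steps and of giant steps for the last entries of the chains in `P`, with a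
bound `L` on the number of baby steps. -/
def tables (p e L : ℕ) (P : List (List ℕ)) :
    Prog (List (ℕ × List ℕ) × List (ℕ × List ℕ)) :=
  -- The first component is the remaining budget of baby steps. While it is at least `p`, a
  -- coordinate goes entirely to the baby steps; one coordinate may be split into digits to a
  -- smaller base; all later ones go to the giant steps. Exponents are prepended, so the reversal
  -- puts them in the order of `P`. The power `p - 1` inverts an element of order `p`.
  (Prog.fold P.reverse (L, [(e, ([] : List ℕ))], [(e, ([] : List ℕ))]) fun s c =>
    (power e (c.getD (c.length - 1) e) (p - 1)).bind fun w =>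
      (extend s.2.1 w (max 1 (min p s.1)) 1).bind fun T =>
        (power e (c.getD (c.length - 1) e) (max 1 (min p s.1))).bind fun w =>
          (extend s.2.2 w ((p - 1) / max 1 (min p s.1) + 1) (max 1 (min p s.1))).bind fun D =>
            Prog.ret (s.1 / p, T, D)).bind
  fun s => Prog.ret s.2

/-- The exponents of the first match between the two tables. -/
def findMatch (Z T : List (ℕ × List ℕ)) : Option (List ℕ × List ℕ) :=
  (Z.flatMap fun z => T.flatMap fun t => if t.1 = z.1 then [(t.2, z.2)] else []).head?

/-- Search for exponents that express the inverse of `y` by means of the tables. -/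
def search (y : ℕ) (T D : List (ℕ × List ℕ)) : Prog (Option (List ℕ × List ℕ)) :=
  (Prog.collect D fun d => (Prog.mul y d.1).bind fun z => Prog.ret [(z, d.2)]).bind
  fun Z => Prog.ret (findMatch Z T)

/-- Multiply `u`, the head of a chain of length `a`, with powers of elements of the chains in `P`,
with exponents given by the sum of two lists. -/
def reduce (e a u : ℕ) (P : List (List ℕ)) (xs ys : List ℕ) : Prog ℕ :=
  (Prog.fold P (u, xs, ys) fun s c =>
    (power e (c.getD (c.length - a) e) (s.2.1.headI + s.2.2.headI)).bind fun h =>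
      (Prog.mul s.1 h).bind fun u => Prog.ret (u, s.2.1.tail, s.2.2.tail)).bind
  fun s => Prog.ret s.1

/-- The chains of an independent family, the chains of the other generators, and the tables of baby
and giant steps for the family. -/
abbrev State : Type :=
  List (List ℕ) × List (List ℕ) × List (ℕ × List ℕ) × List (ℕ × List ℕ)

/-- Process the chain `u`, if its length is `a`: either its element can be replaced by one of
smaller order, or it is added to the independent family. -/
def levelStep (p e n a : ℕ) (s : State) (u : List ℕ) : Prog State :=
  Prog.ifEq u.length a
    ((search (u.getD (u.length - 1) e) s.2.2.1 s.2.2.2).bind fun o =>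
      Prog.cases o
        ((tables p e ((n - s.1.length) * (Nat.sqrt (p ^ (s.1.length + 1)) + 1)) (u :: s.1)).bind
          fun t => Prog.ret (u :: s.1, s.2.1, t.1, t.2))
        fun x => (reduce e a (u.getD 0 e) s.1 x.1 x.2).bind fun h =>
          (chain p e h).bind fun c => Prog.ret (s.1, c :: s.2.1, s.2.2.1, s.2.2.2))
    (Prog.ret (s.1, u :: s.2.1, s.2.2.1, s.2.2.2))

/-- Process all chains of length `a`. -/
def level (p e n a : ℕ) (s : State) : Prog State :=
  Prog.fold s.2.1 (s.1, ([] : List (List ℕ)), s.2.2.1, s.2.2.2) (levelStep p e n a)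

/-- Compute a basis of the `p`-group generated by `S`. -/
def basis (p e : ℕ) (S : List ℕ) : Prog (List ℕ) :=
  (Prog.collect S fun g => (chain p e g).bind fun c => Prog.ret [c]).bind fun U =>
    (Prog.fold (List.range U.flatten.length)
      (([] : List (List ℕ)), U, [(e, ([] : List ℕ))], [(e, ([] : List ℕ))])
      fun s i => level p e S.length (U.flatten.length - i) s).bind
    fun s => Prog.ret (s.1.map List.headI)

section Rules

variable [Primcodable σ]

@[fun_prop]
theorem primrec_power {e g x : σ → ℕ} {l : σ → List ℕ} (he : Primrec e) (hg : Primrec g)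
    (hx : Primrec x) (hl : Primrec l) : Primrec fun s => power (e s) (g s) (x s) (l s) := by
  unfold power
  fun_prop

@[fun_prop]
theorem primrec_chain {p e g : σ → ℕ} {l : σ → List ℕ} (hp : Primrec p) (he : Primrec e)
    (hg : Primrec g) (hl : Primrec l) : Primrec fun s => chain (p s) (e s) (g s) (l s) := by
  unfold chain
  fun_prop

@[fun_prop]
theorem primrec_extend {T : σ → List (ℕ × List ℕ)} {w q inc : σ → ℕ} {l : σ → List ℕ}
    (hT : Primrec T) (hw : Primrec w) (hq : Primrec q) (hi : Primrec inc) (hl : Primrec l) :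
    Primrec fun s => extend (T s) (w s) (q s) (inc s) (l s) := by
  unfold extend
  fun_prop

@[fun_prop]
theorem primrec_tables {p e L : σ → ℕ} {P : σ → List (List ℕ)} {l : σ → List ℕ}
    (hp : Primrec p) (he : Primrec e) (hL : Primrec L) (hP : Primrec P) (hl : Primrec l) :
    Primrec fun s => tables (p s) (e s) (L s) (P s) (l s) := by
  unfold tables
  fun_prop

@[fun_prop]
theorem primrec_findMatch {Z T : σ → List (ℕ × List ℕ)} (hZ : Primrec Z) (hT : Primrec T) :
    Primrec fun s => findMatch (Z s) (T s) := by
  unfold findMatch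
  fun_prop

@[fun_prop]
theorem primrec_search {y : σ → ℕ} {T D : σ → List (ℕ × List ℕ)} {l : σ → List ℕ}
    (hy : Primrec y) (hT : Primrec T) (hD : Primrec D) (hl : Primrec l) :
    Primrec fun s => search (y s) (T s) (D s) (l s) := by
  unfold search
  fun_prop

@[fun_prop]
theorem primrec_reduce {e a u : σ → ℕ} {P : σ → List (List ℕ)} {xs ys : σ → List ℕ}
    {l : σ → List ℕ} (he : Primrec e) (ha : Primrec a) (hu : Primrec u) (hP : Primrec P)
    (hxs : Primrec xs) (hys : Primrec ys) (hl : Primrec l) :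
    Primrec fun s => reduce (e s) (a s) (u s) (P s) (xs s) (ys s) (l s) := by
  unfold reduce
  fun_prop

@[fun_prop]
theorem primrec_levelStep {p e n a : σ → ℕ} {st : σ → State} {u : σ → List ℕ} {l : σ → List ℕ}
    (hp : Primrec p) (he : Primrec e) (hn : Primrec n) (ha : Primrec a) (hst : Primrec st)
    (hu : Primrec u) (hl : Primrec l) :
    Primrec fun s => levelStep (p s) (e s) (n s) (a s) (st s) (u s) (l s) := by
  unfold levelStep
  fun_prop

@[fun_prop]
theorem primrec_level {p e n a : σ → ℕ} {st : σ → State} {l : σ → List ℕ}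
    (hp : Primrec p) (he : Primrec e) (hn : Primrec n) (ha : Primrec a) (hst : Primrec st)
    (hl : Primrec l) :
    Primrec fun s => level (p s) (e s) (n s) (a s) (st s) (l s) := by
  unfold level
  fun_prop

@[fun_prop]
theorem primrec_basis {p e : σ → ℕ} {S : σ → List ℕ} {l : σ → List ℕ}
    (hp : Primrec p) (he : Primrec e) (hS : Primrec S) (hl : Primrec l) :
    Primrec fun s => basis (p s) (e s) (S s) (l s) := by
  unfold basis
  fun_prop

end Rules

/-- The next request of the basis algorithm. -/
def nextRequest (v : GenericView) : GenericRequest :=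
  Sum.elim (fun r => Sum.inl r) (fun r => Sum.inr (Sum.inr r.1)) (basis v.1 v.2.1 v.2.2.1 v.2.2.2)

theorem primrec_nextRequest : Primrec nextRequest := by
  have h : Primrec fun v : GenericView => basis v.1 v.2.1 v.2.2.1 v.2.2.2 := by fun_prop
  have h' := Primrec.sumCasesOn (g := fun (_ : GenericView) (x : ℕ × ℕ) =>
    (Sum.inl x : GenericRequest))
    (h := fun (_ : GenericView) (r : List ℕ × List ℕ) => (Sum.inr (Sum.inr r.1) : GenericRequest))
    h (Primrec.sumInl.comp Primrec.snd) (Primrec.sumInr.comp (Primrec.sumInr.comp (by fun_prop)))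
  refine h'.of_eq fun v => ?_
  unfold nextRequest
  cases basis v.1 v.2.1 v.2.2.1 v.2.2.2 <;> rfl

/-- The basis algorithm. -/
def algorithm : GenericAlgorithm where
  next v := Part.some (nextRequest v)
  effective := primrec_nextRequest.to_comp.partrec

end Programs

/-! ### Correctness and cost of programs: a Hoare logic -/

section Semantics

variable {G : Type*} [CommGroup G] {enc : G ↪ ℕ} {α β : Type*}

/-- When the elements of `K` are known, the program `q` asks for the products `gs`, one after the
other, and returns `x`. -/
def Sim (enc : G ↪ ℕ) (K : Set G) (q : Prog α) (gs : List G) (x : α) : Prop :=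
  (∀ rest, q (gs.map enc ++ rest) = Sum.inr (x, rest)) ∧
    ∀ l g l', gs = l ++ g :: l' → ∃ a b, (a ∈ K ∨ a ∈ l) ∧ (b ∈ K ∨ b ∈ l) ∧ g = a * b ∧
      q (l.map enc) = Sum.inl (enc a, enc b)

/-- When the elements of `K` are known, the program `q` terminates with a value, a set of known
elements and a number of multiplications that satisfy `Post`. -/
def Runs (enc : G ↪ ℕ) (K : Set G) (q : Prog α) (Post : α → Set G → ℕ → Prop) : Prop :=
  ∃ gs x, Sim enc K q gs x ∧ Post x (K ∪ {g | g ∈ gs}) gs.length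

theorem split_append {γ : Type*} {gs hs l l' : List γ} {g : γ} (h : gs ++ hs = l ++ g :: l') :
    (∃ t, gs = l ++ g :: t) ∨ ∃ t, l = gs ++ t ∧ hs = t ++ g :: l' := by
  rcases List.append_eq_append_iff.1 h with ⟨t, h1, h2⟩ | ⟨t, h1, h2⟩
  · exact Or.inr ⟨t, h1, h2⟩
  · rcases t with _ | ⟨b, t⟩
    · exact Or.inr ⟨[], by simp_all, by simpa using h2.symm⟩
    · simp only [List.cons_append, List.cons.injEq] at h2
      exact Or.inl ⟨t, by rw [h1, h2.1]⟩

theorem Sim.bind {K : Set G} {q : Prog α} {f : α → Prog β} {gs hs : List G} {x : α} {y : β}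
    (hq : Sim enc K q gs x) (hf : Sim enc (K ∪ {g | g ∈ gs}) (f x) hs y) :
    Sim enc K (q.bind f) (gs ++ hs) y := by
  refine ⟨fun rest => ?_, fun l g l' h => ?_⟩
  · simp [Prog.bind, hq.1, hf.1]
  · rcases split_append h with ⟨t, rfl⟩ | ⟨t, rfl, rfl⟩
    · obtain ⟨a, b, ha, hb, hg, he⟩ := hq.2 l g t rfl
      exact ⟨a, b, ha, hb, hg, by simp [Prog.bind, he]⟩
    · obtain ⟨a, b, ha, hb, hg, he⟩ := hf.2 t g l' rfl
      refine ⟨a, b, ?_, ?_, hg, by simp [Prog.bind, hq.1, he]⟩ <;>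
        simp only [Set.mem_union, Set.mem_ofPred_eq, List.mem_append] at * <;> tauto

theorem Runs.mono {K : Set G} {q : Prog α} {P Q : α → Set G → ℕ → Prop} (h : Runs enc K q P)
    (hPQ : ∀ x K' k, K ⊆ K' → P x K' k → Q x K' k) : Runs enc K q Q := by
  obtain ⟨gs, x, hs, hp⟩ := h
  exact ⟨gs, x, hs, hPQ _ _ _ Set.subset_union_left hp⟩

theorem Runs.bind {K : Set G} {q : Prog α} {f : α → Prog β} {P : β → Set G → ℕ → Prop}
    (h : Runs enc K q fun x K' k => K ⊆ K' → Runs enc K' (f x) fun y K'' k' => P y K'' (k + k')) :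
    Runs enc K (q.bind f) P := by
  obtain ⟨gs, x, hs, hp⟩ := h
  obtain ⟨hs', y, hs2, hp2⟩ := hp Set.subset_union_left
  refine ⟨gs ++ hs', y, hs.bind hs2, ?_⟩
  have : K ∪ {g | g ∈ gs ++ hs'} = K ∪ {g | g ∈ gs} ∪ {g | g ∈ hs'} := by
    ext; simp [or_assoc]
  rw [this, List.length_append]
  exact hp2

theorem Runs.ret {K : Set G} {x : α} {P : α → Set G → ℕ → Prop} (h : P x K 0) :
    Runs enc K (Prog.ret x) P :=
  ⟨[], x, ⟨by simp [Prog.ret], by simp⟩, by simpa using h⟩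

theorem Runs.mul {K : Set G} {a b : G} (ha : a ∈ K) (hb : b ∈ K) {P : ℕ → Set G → ℕ → Prop}
    (h : ∀ K', K ⊆ K' → a * b ∈ K' → P (enc (a * b)) K' 1) :
    Runs enc K (Prog.mul (enc a) (enc b)) P := by
  refine ⟨[a * b], enc (a * b), ⟨by simp [Prog.mul], fun l g l' h => ?_⟩,
    h _ Set.subset_union_left (by simp)⟩
  rcases l with _ | ⟨c, l⟩
  · simp only [List.nil_append, List.cons.injEq] at h
    exact ⟨a, b, Or.inl ha, Or.inl hb, h.1.symm, by simp [Prog.mul]⟩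
  · simp at h

theorem Runs.ifEq {K : Set G} {a b : ℕ} {q r : Prog α} {P : α → Set G → ℕ → Prop}
    (hq : a = b → Runs enc K q P) (hr : a ≠ b → Runs enc K r P) :
    Runs enc K (Prog.ifEq a b q r) P := by
  by_cases h : a = b
  · rw [show Prog.ifEq a b q r = q from funext fun l => if_pos h]
    exact hq h
  · rw [show Prog.ifEq a b q r = r from funext fun l => if_neg h]
    exact hr h

theorem Runs.cases_none {K : Set G} {q : Prog α} {f : β → Prog α} {P : α → Set G → ℕ → Prop}
    (h : Runs enc K q P) : Runs enc K (Prog.cases none q f) P := h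

theorem Runs.cases_some {K : Set G} {q : Prog α} {f : β → Prog α} {P : α → Set G → ℕ → Prop}
    {x : β} (h : Runs enc K (f x) P) : Runs enc K (Prog.cases (some x) q f) P := h

theorem foldl_inl {L : List β} {f : α → β → Prog α} (r : ℕ × ℕ) :
    L.foldl (fun r b => Sum.elim Sum.inl (fun r => f r.1 b r.2) r)
      (Sum.inl r : (ℕ × ℕ) ⊕ (α × List ℕ)) = Sum.inl r := by
  induction L with
  | nil => rfl
  | cons b L ih => simpa using ih

/-- A request made inside the loop survives the remaining iterations by `foldl_inl`, so loops unfold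
one step at a time. -/
theorem fold_cons (b : β) (L : List β) (x : α) (f : α → β → Prog α) :
    Prog.fold (b :: L) x f = (f x b).bind fun y => Prog.fold L y f := by
  funext l
  simp only [Prog.fold, Prog.bind, List.foldl_cons, Sum.elim_inr]
  rcases f x b l with r | r
  · simpa using foldl_inl r
  · rfl

/-- The loop rule: the invariant depends on the part of the list still to be processed and on the
cost so far. -/
theorem Runs.fold {K : Set G} {L : List β} {x : α} {f : α → β → Prog α}
    {P : α → Set G → ℕ → Prop} (I : List β → α → Set G → ℕ → Prop) (h0 : I L x K 0)
    (hstep : ∀ b l x K' k, K ⊆ K' → I (b :: l) x K' k →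
      Runs enc K' (f x b) fun y K'' k' => I l y K'' (k + k'))
    (hP : ∀ x K' k, K ⊆ K' → I [] x K' k → P x K' k) :
    Runs enc K (Prog.fold L x f) P := by
  suffices H : ∀ (L : List β) (x : α) (K' : Set G) (k : ℕ), K ⊆ K' → I L x K' k →
      Runs enc K' (Prog.fold L x f) fun y K'' k' => I [] y K'' (k + k') by
    refine (H L x K 0 subset_rfl h0).mono fun y K' k hK h => hP _ _ _ hK ?_
    simpa using h
  intro L
  induction L with
  | nil => exact fun x K' k _ h => Runs.ret (x := x) (by simpa using h)
  | cons b L ih =>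
    intro x K' k hK h
    rw [fold_cons]
    refine Runs.bind ((hstep b L x K' k hK h).mono fun y K'' k' hK' h' hK'' => ?_)
    refine (ih y K'' _ (hK.trans hK') h').mono fun z _ k'' _ hz => ?_
    rwa [← add_assoc]

theorem Runs.collect {K : Set G} {L : List β} {f : β → Prog (List α)}
    {P : List α → Set G → ℕ → Prop} (I : List β → List α → Set G → ℕ → Prop) (h0 : I L [] K 0)
    (hstep : ∀ b l acc K' k, K ⊆ K' → I (b :: l) acc K' k →
      Runs enc K' (f b) fun y K'' k' => I l (acc ++ y) K'' (k + k'))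
    (hP : ∀ x K' k, K ⊆ K' → I [] x K' k → P x K' k) :
    Runs enc K (Prog.collect L f) P :=
  Runs.fold I h0 (fun b l acc K' k hK hI => Runs.bind ((hstep b l acc K' k hK hI).mono
    fun _ _ _ _ h _ => Runs.ret (by simpa using h))) hP

/-- A version of `Sim` for loops: only the behaviour on fewer than `N` answers matters. -/
def SimBelow (enc : G ↪ ℕ) (N : ℕ) (K : Set G) (q : Prog α) (gs : List G) (x : α) : Prop :=
  (gs.length < N → ∀ rest, q (gs.map enc ++ rest) = Sum.inr (x, rest)) ∧
    ∀ l g l', gs = l ++ g :: l' → l.length < N →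
      ∃ a b, (a ∈ K ∨ a ∈ l) ∧ (b ∈ K ∨ b ∈ l) ∧ g = a * b ∧
        q (l.map enc) = Sum.inl (enc a, enc b)

/-- The number of iterations is not known in advance, so the unread answers serve as fuel. An
iteration either is a fixed point or consumes at least one answer; with one unit of fuel more than
there are answers, the loop cannot run out before it stops or makes a request. The measure `μ` gives
termination. -/
theorem Runs.iter {K : Set G} {x : α} {f : α → Prog α} {P : α → Set G → ℕ → Prop}
    (I : α → Set G → ℕ → Prop) (μ : α → ℕ) (h0 : I x K 0)
    (hstep : ∀ x K' k, K ⊆ K' → I x K' k → (f x = Prog.ret x ∧ P x K' k) ∨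
      Runs enc K' (f x) fun y K'' k' => 0 < k' ∧ μ y < μ x ∧ I y K'' (k + k')) :
    Runs enc K (Prog.iter x f) P := by
  -- The sequence of answers is chosen before the fuel `F`, because the fuel varies with the prefix
  -- on which the program is replayed.
  suffices H : ∀ (n : ℕ) (x : α) (K' : Set G) (k : ℕ), μ x = n → K ⊆ K' → I x K' k →
      ∃ gs y, P y (K' ∪ {g | g ∈ gs}) (k + gs.length) ∧
        ∀ F : List ℕ, SimBelow enc F.length K' (Prog.fold F x fun x _ => f x) gs y by
    obtain ⟨gs, y, hP, hF⟩ := H _ x K 0 rfl subset_rfl h0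
    refine ⟨gs, y, ⟨fun rest => ?_, fun l g l' h => ?_⟩, by simpa using hP⟩
    · exact (hF (0 :: (gs.map enc ++ rest))).1 (by simp) rest
    · exact (hF (0 :: l.map enc)).2 l g l' h (by simp)
  intro n
  induction n using Nat.strong_induction_on with
  | _ n ih =>
    intro x K' k hμ hK hI
    rcases hstep x K' k hK hI with ⟨hf, hP⟩ | ⟨gs, y, hsim, hk, hμ', hI'⟩
    · refine ⟨[], x, by simpa using hP, fun F => ?_⟩
      have hid : ∀ F : List ℕ, Prog.fold F x (fun x _ => f x) = Prog.ret x := by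
        intro F
        induction F with
        | nil => rfl
        | cons b F ihF =>
          rw [fold_cons, hf]
          funext l
          simp only [Prog.bind, Prog.ret, Sum.elim_inr, ihF]
      rw [hid]
      exact ⟨fun _ => by simp [Prog.ret], by simp⟩
    · obtain ⟨hs, z, hP, hF⟩ := ih (μ y) (hμ ▸ hμ') y _ _ rfl
        (hK.trans Set.subset_union_left) hI'
      refine ⟨gs ++ hs, z, ?_, fun F => ?_⟩
      · have : K' ∪ {g | g ∈ gs ++ hs} = K' ∪ {g | g ∈ gs} ∪ {g | g ∈ hs} := by
          ext; simp [or_assoc]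
        rw [this, List.length_append, ← add_assoc]
        exact hP
      · rcases F with _ | ⟨b, F⟩
        · exact ⟨by simp, by simp⟩
        · rw [fold_cons]
          refine ⟨fun hl rest => ?_, fun l g l' h hl => ?_⟩
          · simp only [List.length_append, List.length_cons] at hl
            simp [Prog.bind, hsim.1, (hF F).1 (by omega)]
          · rcases split_append h with ⟨t, rfl⟩ | ⟨t, rfl, rfl⟩
            · obtain ⟨a, b, ha, hb, hg, he⟩ := hsim.2 l g t rfl
              exact ⟨a, b, ha, hb, hg, by simp [Prog.bind, he]⟩
            · simp only [List.length_append, List.length_cons] at hl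
              obtain ⟨a, b, ha, hb, hg, he⟩ := (hF F).2 t g l' rfl (by omega)
              refine ⟨a, b, ?_, ?_, hg, by simp [Prog.bind, hsim.1, he]⟩ <;>
                simp only [Set.mem_union, Set.mem_ofPred_eq, List.mem_append] at * <;> tauto

/-- A terminating run of the program yields a run of the algorithm. -/
theorem exists_run {p : ℕ} {S : List G} {P : List ℕ → Set G → ℕ → Prop}
    (h : Runs enc {g | g ∈ GenericAlgorithm.known S []} (basis p (enc 1) (S.map enc)) P)
    (hP : ∀ x K k, P x K k → ∃ out : List G, (∀ g ∈ out, g ∈ K) ∧ x = out.map enc) :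
    ∃ k out K, P (out.map enc) K k ∧ algorithm.Run p enc S [] k out := by
  obtain ⟨gs, x, hsim, hp⟩ := h
  obtain ⟨out, hout, rfl⟩ := hP _ _ _ hp
  refine ⟨gs.length, out, _, hp, ?_⟩
  -- Induction on the products still to be requested; `l` is the list of those already answered.
  suffices H : ∀ l' l : List G, gs = l ++ l' → algorithm.Run p enc S l l'.length out by
    exact H gs [] rfl
  intro l'
  induction l' with
  | nil =>
    intro l hl
    obtain rfl : gs = l := by simpa using hl
    refine .halt _ _ (fun g hg => ?_) ?_
    · have := hout g hg
      simp only [GenericAlgorithm.known, Set.mem_union, Set.mem_ofPred_eq, List.mem_cons,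
        List.mem_append, List.append_nil] at this ⊢
      tauto
    · have := hsim.1 []
      simp only [List.append_nil] at this
      simp [algorithm, nextRequest, GenericAlgorithm.view, this]
  | cons g l' ih =>
    intro l hl
    obtain ⟨a, b, ha, hb, rfl, he⟩ := hsim.2 l g l' hl
    refine .mul l a b _ out ?_ ?_ ?_ (ih _ (by simpa using hl))
    · simp only [GenericAlgorithm.known, Set.mem_ofPred_eq, List.mem_cons, List.mem_append,
        List.append_nil] at ha ⊢
      tauto
    · simp only [GenericAlgorithm.known, Set.mem_ofPred_eq, List.mem_cons, List.mem_append,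
        List.append_nil] at hb ⊢
      tauto
    · simp [algorithm, nextRequest, GenericAlgorithm.view, he]

end Semantics

/-! ### Linear combinations and independence modulo `p` -/

section Combinations

variable {G : Type*} [CommGroup G] {p : ℕ}

/-- The product of the powers of the elements of `ws`, with exponents `xs`. -/
def comb : List G → List ℕ → G
  | [], _ => 1
  | w :: ws, xs => w ^ xs.headI * comb ws xs.tail

/-- The elements of `ws`, which have order dividing `p`, are linearly independent modulo `p`. -/
def Indep (p : ℕ) (ws : List G) : Prop :=
  ∀ f : Fin ws.length → ℕ, ∏ i, ws.get i ^ f i = 1 → ∀ i, p ∣ f i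

theorem comb_eq_prod (ws : List G) (xs : List ℕ) :
    comb ws xs = ∏ i : Fin ws.length, ws.get i ^ xs.getD i 0 := by
  induction ws generalizing xs with
  | nil => simp [comb]
  | cons w ws ih =>
    rw [comb, ih]
    simp only [List.length_cons, Fin.prod_univ_succ]
    cases xs <;> simp

theorem prod_eq_comb (ws : List G) (f : Fin ws.length → ℕ) :
    ∏ i, ws.get i ^ f i = comb ws (List.ofFn f) := by
  rw [comb_eq_prod]
  refine Finset.prod_congr rfl fun i _ => ?_
  simp

/-- In a relation where the exponent of `y` is prime to `p`, raising to its inverse modulo `p` makes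
that exponent `1` and gives a relation excluded by `hno`. -/
theorem Indep.cons [hp : Fact p.Prime] {ws : List G} (h : Indep p ws) {y : G} (hy : y ^ p = 1)
    (hws : ∀ w ∈ ws, w ^ p = 1)
    (hno : ∀ xs : List ℕ, xs.length = ws.length → (∀ x ∈ xs, x < p) → y * comb ws xs ≠ 1) :
    Indep p (y :: ws) := by
  intro f hf
  simp only [List.length_cons, Fin.prod_univ_succ, List.get_cons_zero] at hf
  have h0 : p ∣ f 0 := by
    by_contra hdvd
    obtain ⟨k, hk⟩ := Nat.exists_mul_mod_eq_one_of_coprime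
      ((Nat.Prime.coprime_iff_not_dvd hp.out).2 hdvd).symm hp.out.one_lt
    refine hno (List.ofFn fun i => k * f i.succ % p) (by simp) ?_ ?_
    · intro x hx
      obtain ⟨i, rfl⟩ := (List.mem_ofFn' _ _).1 hx
      exact Nat.mod_lt _ hp.out.pos
    · rw [← prod_eq_comb]
      have h1 := congrArg (· ^ k) hf
      simp only [mul_pow, one_pow, ← Finset.prod_pow, ← pow_mul] at h1
      have e1 : y ^ (f 0 * k) = y := by
        rw [pow_eq_pow_mod _ hy, hk.2, pow_one]
      rw [e1] at h1
      rw [← h1]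
      congr 1
      refine Finset.prod_congr rfl fun i _ => ?_
      rw [← pow_eq_pow_mod _ (hws _ (List.get_mem ws i)), mul_comm]
      rfl
  have hy0 : y ^ f 0 = 1 := by
    obtain ⟨c, hc⟩ := h0
    rw [hc, pow_mul, hy, one_pow]
  rw [hy0, one_mul] at hf
  exact fun i => Fin.cases h0 (h _ hf) i

theorem Indep.nil : Indep p ([] : List G) := fun _ _ i => i.elim0

/-- Keeps all exponents natural numbers where inverses are needed. -/
theorem pow_mul_orderOf_sub_one {H : Type*} [Group H] [Finite H] (g : H) (x : ℕ) :
    g ^ (x * (orderOf g - 1)) = (g ^ x)⁻¹ := by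
  rw [eq_inv_iff_mul_eq_one, ← pow_add, ← Nat.mul_add_one,
    Nat.sub_add_cancel (orderOf_pos g), mul_comm, pow_mul, pow_orderOf_eq_one, one_pow]

theorem exists_prod_pow_eq {H ι : Type*} [CommGroup H] [Finite H] [Fintype ι] {v : ι → H}
    (hv : Subgroup.closure (Set.range v) = ⊤) (h : H) : ∃ f : ι → ℕ, ∏ i, v i ^ f i = h := by
  classical
  have hh : h ∈ Subgroup.closure (Set.range v) := hv ▸ Subgroup.mem_top h
  induction hh using Subgroup.closure_induction with
  | mem x hx =>
    obtain ⟨i, rfl⟩ := hx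
    refine ⟨Pi.single i 1, ?_⟩
    rw [Finset.prod_eq_single i (fun j _ hj => by simp [hj]) (by simp)]
    simp
  | one => exact ⟨0, by simp⟩
  | mul x y _ _ hx hy =>
    obtain ⟨f, rfl⟩ := hx
    obtain ⟨g, rfl⟩ := hy
    exact ⟨f + g, by simp [pow_add, Finset.prod_mul_distrib]⟩
  | inv x _ hx =>
    obtain ⟨f, rfl⟩ := hx
    refine ⟨fun i => f i * (orderOf (v i) - 1), ?_⟩
    simp only [pow_mul_orderOf_sub_one, Finset.prod_inv_distrib]

/-- The number of elements of order dividing `p` is at most `p` to the rank. -/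
theorem card_ker_pow_le {p : ℕ} (hp : 0 < p) (H : Type*) [CommGroup H] [Finite H] :
    Nat.card (powMonoidHom p : H →* H).ker ≤ p ^ Group.rank H := by
  obtain ⟨S, hS, hS'⟩ := Group.rank_spec H
  set φ : H →* H := powMonoidHom p
  -- Splitting every exponent as `f % p + p * (f / p)` shows that `|H|` is at most `p ^ rank` times
  -- the number of `p`-th powers; the claim follows on dividing by that number.
  have hsurj : Function.Surjective fun c : ({h : H // h ∈ S} → Fin p) × φ.range =>
      (∏ s : {h : H // h ∈ S}, (s : H) ^ (c.1 s : ℕ)) * c.2 := by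
    intro h
    obtain ⟨f, rfl⟩ := exists_prod_pow_eq (v := fun s : {h : H // h ∈ S} => (s : H))
      (by simpa using hS') h
    refine ⟨(fun s => ⟨f s % p, Nat.mod_lt _ hp⟩,
      ⟨∏ s : {h : H // h ∈ S}, ((s : H) ^ (f s / p)) ^ p,
        ∏ s : {h : H // h ∈ S}, (s : H) ^ (f s / p), ?_⟩), ?_⟩
    · simp [φ, Finset.prod_pow]
    · simp only [← Finset.prod_mul_distrib]
      refine Finset.prod_congr rfl fun s _ => ?_
      rw [← pow_mul, ← pow_add, mul_comm (f s / p), Nat.mod_add_div]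
  have h1 := Nat.card_le_card_of_surjective _ hsurj
  rw [Nat.card_prod, Nat.card_fun, Nat.card_fin, Nat.card_eq_fintype_card (α := {h : H // h ∈ S}),
    Fintype.card_coe, hS] at h1
  have h2 : Nat.card φ.ker * Nat.card φ.range = Nat.card H := by
    rw [← Subgroup.card_mul_index φ.ker, Subgroup.index_ker]
  rw [← h2] at h1
  exact Nat.le_of_mul_le_mul_right h1 Nat.card_pos

end Combinations

/-! ### Heights, tops and ranks in a `p`-group -/

section Heights

variable {G : Type*} [CommGroup G] {p : ℕ}

/-- The exponent `a` in the order `p ^ a` of an element of a `p`-group. -/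
noncomputable def height (p : ℕ) (g : G) : ℕ := Nat.log p (orderOf g)

/-- The power of order `p` in the cyclic `p`-group generated by `g`. -/
noncomputable def top (p : ℕ) (g : G) : G := g ^ p ^ (height p g - 1)

theorem height_le_log_exponent [Finite G] (g : G) : height p g ≤ Nat.log p (Monoid.exponent G) := by
  rw [height]
  exact Nat.log_mono_right (Nat.le_of_dvd (Nat.pos_of_ne_zero Monoid.exponent_ne_zero_of_finite)
    (Monoid.order_dvd_exponent g))

variable [hp : Fact p.Prime] (hG : IsPGroup p G)
include hG

theorem orderOf_eq_pow_height (g : G) : orderOf g = p ^ height p g := by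
  obtain ⟨k, hk⟩ := IsPGroup.iff_orderOf.1 hG g
  rw [height, hk, Nat.log_pow hp.out.one_lt]

theorem pow_pow_eq_one_iff (g : G) (k : ℕ) : g ^ p ^ k = 1 ↔ height p g ≤ k := by
  rw [← orderOf_dvd_iff_pow_eq_one, orderOf_eq_pow_height hG, Nat.pow_dvd_pow_iff_le_right hp.out.one_lt]

theorem height_eq_zero_iff (g : G) : height p g = 0 ↔ g = 1 := by
  rw [← Nat.le_zero, ← pow_pow_eq_one_iff hG]
  simp

theorem top_pow (g : G) : top p g ^ p = 1 := by
  rw [top, ← pow_mul, ← pow_succ, pow_pow_eq_one_iff hG]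
  omega

/-- Independence of the elements of order `p` gives independence of the elements themselves. -/
theorem pow_eq_one_of_prod_eq_one {P : List G} (hind : Indep p (P.map (top p)))
    (f : Fin P.length → ℕ) (hf : ∏ i, P.get i ^ f i = 1) (i : Fin P.length) :
    P.get i ^ f i = 1 := by
  have hind' : ∀ e : Fin P.length → ℕ, ∏ i, top p (P.get i) ^ e i = 1 → ∀ i, p ∣ e i := by
    intro e he i
    have := hind (fun i => e (i.cast (by simp))) ?_ (i.cast (by simp))
    · simpa using this
    · rw [← he]
      refine Fintype.prod_equiv (finCongr (by simp)) _ _ fun j => ?_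
      simp
  -- Descent on an exponent `p ^ N` that kills every factor. Raised to the power `p ^ N`, a factor
  -- killed by `p ^ (N + 1)` becomes a power of its top; independence of the tops makes it trivial,
  -- so `p ^ N` already kills every factor.
  suffices H : ∀ N (f : Fin P.length → ℕ), (∀ i, (P.get i ^ f i) ^ p ^ N = 1) →
      ∏ i, P.get i ^ f i = 1 → ∀ i, P.get i ^ f i = 1 by
    refine H (∑ i, height p (P.get i)) f (fun i => ?_) hf i
    rw [← pow_mul, mul_comm, pow_mul,
      (pow_pow_eq_one_iff hG _ _).2 (Finset.single_le_sum (f := fun i => height p (P.get i))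
        (fun _ _ => Nat.zero_le _) (Finset.mem_univ i)), one_pow]
  intro N
  induction N with
  | zero => exact fun f h _ i => by simpa using h i
  | succ N ih =>
    intro f h hf
    refine ih f (fun i => ?_) hf
    have hdvd : ∀ i, p ^ (height p (P.get i) - 1) ∣ f i * p ^ N := by
      intro i
      have h1 := h i
      rw [← pow_mul, ← orderOf_dvd_iff_pow_eq_one, orderOf_eq_pow_height hG, pow_succ,
        ← mul_assoc] at h1
      rcases Nat.eq_zero_or_pos (height p (P.get i)) with h0 | h0
      · rw [h0]
        simp
      · obtain ⟨a, ha⟩ := Nat.exists_eq_succ_of_ne_zero h0.ne'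
        rw [ha, Nat.succ_eq_add_one, pow_succ] at h1
        rw [ha]
        exact Nat.dvd_of_mul_dvd_mul_right hp.out.pos h1
    choose e he using hdvd
    have hpow : ∀ i, (P.get i ^ f i) ^ p ^ N = top p (P.get i) ^ e i := fun i => by
      rw [← pow_mul, he, pow_mul, top]
    have h2 : ∏ i, top p (P.get i) ^ e i = 1 := by
      rw [← Finset.prod_congr rfl fun i _ => hpow i, Finset.prod_pow, hf, one_pow]
    obtain ⟨c, hc⟩ := hind' e h2 i
    rw [hpow, hc, pow_mul, top_pow hG, one_pow]

/-- Existence comes from reducing exponents modulo the orders; for uniqueness, the quotient of two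
representations is a relation, all of whose factors are trivial. -/
theorem isGroupBasis_of_indep [Finite G] {P : List G} (hind : Indep p (P.map (top p)))
    (hgen : Subgroup.closure {g | g ∈ P} = ⊤) : IsGroupBasis P := by
  intro β
  have hpos : ∀ i, 0 < orderOf (P.get i) := fun i => orderOf_pos _
  refine existsUnique_of_exists_of_unique ?_ ?_
  · obtain ⟨f, hf⟩ := exists_prod_pow_eq (v := P.get) (by rwa [Set.range_list_get]) β
    refine ⟨fun i => f i % orderOf (P.get i), fun i => Nat.mod_lt _ (hpos i), ?_⟩
    simpa only [pow_mod_orderOf] using hf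
  · rintro x y ⟨hx, hx'⟩ ⟨hy, hy'⟩
    funext i
    have h1 : ∏ i, P.get i ^ (x i + y i * (orderOf (P.get i) - 1)) = 1 := by
      simp only [pow_add, pow_mul_orderOf_sub_one, Finset.prod_mul_distrib,
        Finset.prod_inv_distrib, hx', hy', mul_inv_cancel]
    have h2 := pow_eq_one_of_prod_eq_one hG hind _ h1 i
    have h3 : P.get i ^ x i = P.get i ^ y i := by
      rwa [pow_add, pow_mul_orderOf_sub_one, mul_inv_eq_one] at h2
    exact pow_injOn_Iio_orderOf (hx i) (hy i) h3

/-- The size of an independent family of elements of large order is bounded by a rank. -/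
theorem length_le_powRank [Finite G] {P : List G} (hind : Indep p (P.map (top p))) {j : ℕ}
    (hj : ∀ g ∈ P, j < height p g) : P.length ≤ powRank p G j := by
  set H := (powMonoidHom (p ^ j) : G →* G).range
  have hmem : ∀ w ∈ P.map (top p), w ∈ H := by
    intro w hw
    obtain ⟨g, hg, rfl⟩ := List.mem_map.1 hw
    refine ⟨g ^ p ^ (height p g - 1 - j), ?_⟩
    have := hj g hg
    rw [powMonoidHom_apply, ← pow_mul, ← pow_add, top]
    congr 2
    omega
  have hone : ∀ w ∈ P.map (top p), w ^ p = 1 := by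
    intro w hw
    obtain ⟨g, hg, rfl⟩ := List.mem_map.1 hw
    exact top_pow hG g
  set ws := P.map (top p)
  -- The tops are `p ^ j`-th powers killed by `p`. Their `p ^ |P|` combinations are distinct, so `p
  -- ^ |P|` is at most the order of the `p`-torsion of `H`, hence at most `p ^ rank H`.
  let F : (Fin ws.length → Fin p) → (powMonoidHom p : H →* H).ker := fun f =>
    ⟨⟨∏ i, ws.get i ^ (f i : ℕ), Subgroup.prod_mem _ fun i _ =>
      Subgroup.pow_mem _ (hmem _ (List.get_mem _ _)) _⟩, by
        rw [MonoidHom.mem_ker, powMonoidHom_apply]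
        ext
        push_cast
        rw [← Finset.prod_pow]
        refine Finset.prod_eq_one fun i _ => ?_
        rw [← pow_mul, mul_comm, pow_mul, hone _ (List.get_mem _ _), one_pow]⟩
  have hF : Function.Injective F := by
    intro f g hfg
    have h1 : ∏ i, ws.get i ^ (f i : ℕ) = ∏ i, ws.get i ^ (g i : ℕ) :=
      congrArg (fun x : (powMonoidHom p : H →* H).ker => ((x : H) : G)) hfg
    -- Modulo `p` this exponent is the difference `f i - g i`.
    have h2 := hind (fun i => f i + (p - 1) * g i) ?_
    · funext i
      have h3 := h2 i
      have h5 : ((f i : ℕ) : ZMod p) = ((g i : ℕ) : ZMod p) := by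
        have h4 := (ZMod.natCast_eq_zero_iff _ p).2 h3
        rw [Nat.cast_add, Nat.cast_mul, Nat.cast_sub hp.out.one_le, ZMod.natCast_self] at h4
        linear_combination h4
      rw [ZMod.natCast_eq_natCast_iff'] at h5
      rw [Nat.mod_eq_of_lt (f i).2, Nat.mod_eq_of_lt (g i).2] at h5
      exact Fin.ext h5
    · simp only [pow_add, Finset.prod_mul_distrib, pow_mul']
      rw [Finset.prod_pow, h1, ← pow_succ', Nat.sub_add_cancel hp.out.one_le, ← Finset.prod_pow]
      refine Finset.prod_eq_one fun i _ => ?_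
      rw [← pow_mul, mul_comm, pow_mul, hone _ (List.get_mem _ _), one_pow]
  have h1 := (Nat.card_le_card_of_injective F hF).trans (card_ker_pow_le hp.out.pos H)
  rw [Nat.card_fun, Nat.card_fin, Nat.card_fin] at h1
  rw [← List.length_map (f := top p)]
  exact (Nat.pow_le_pow_iff_right hp.out.one_lt).1 h1

/-- The rank of the group of `p ^ j`-th powers is at most the number of generators of larger
order. -/
theorem powRank_le_countP [Finite G] {L : List G} (hgen : Subgroup.closure {g | g ∈ L} = ⊤)
    (j : ℕ) : powRank p G j ≤ L.countP (fun g => j < height p g) := by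
  classical
  set φ : G →* G := powMonoidHom (p ^ j)
  -- Generators of height at most `j` have trivial `p ^ j`-th power and can be dropped.
  have h1 : φ.range = Subgroup.closure
      (((L.filter fun g => j < height p g).map φ).toFinset : Set G) := by
    rw [MonoidHom.range_eq_map, ← hgen, MonoidHom.map_closure]
    refine le_antisymm ((Subgroup.closure_le _).2 ?_) (Subgroup.closure_mono ?_)
    · rintro _ ⟨g, hg, rfl⟩
      by_cases h : j < height p g
      · refine Subgroup.subset_closure ?_
        simp only [List.coe_toFinset, Set.mem_ofPred_eq, List.mem_map, List.mem_filter]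
        exact ⟨g, ⟨hg, by simpa using h⟩, rfl⟩
      · have : φ g = 1 := (pow_pow_eq_one_iff hG g j).2 (not_lt.1 h)
        rw [this]
        exact Subgroup.one_mem _
    · intro x hx
      simp only [List.coe_toFinset, Set.mem_ofPred_eq, List.mem_map, List.mem_filter] at hx
      obtain ⟨g, ⟨hg, -⟩, rfl⟩ := hx
      exact ⟨g, hg, rfl⟩
  rw [powRank, Subgroup.rank_congr h1]
  refine (Subgroup.rank_closure_finset_le_card _).trans ((List.toFinset_card_le _).trans ?_)
  rw [List.length_map, List.countP_eq_length_filter]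

end Heights

/-! ### Powers by repeated squaring -/

section Power

variable {G : Type*} [CommGroup G] {enc : G ↪ ℕ} {K : Set G}

theorem size_div_two {z : ℕ} (hz : z ≠ 0) : Nat.size (z / 2) + 1 = Nat.size z := by
  have h := Nat.bit_bodd_div2 z
  conv_rhs => rw [← h]
  rw [Nat.size_bit (by rwa [h]), Nat.div2_val]

/-- The loop preserves `a * b ^ z = g ^ x` and spends two products per binary digit of `x`. Halving
decreases a nonzero `z`, so `x` iterations suffice. That a positive power costs at least one product
is what `Runs.iter` requires in `runs_chain`. -/
theorem runs_power {g : G} (hg : g ∈ K) (h1 : (1 : G) ∈ K) (x : ℕ) :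
    Runs enc K (power (enc 1) (enc g) x) fun y K' k =>
      y = enc (g ^ x) ∧ g ^ x ∈ K' ∧ k ≤ 2 * Nat.size x ∧ (0 < x → 0 < k) := by
  refine Runs.bind (Runs.fold (fun l s K' k => ∃ a b z, s = (enc a, enc b, z) ∧ a ∈ K' ∧ b ∈ K' ∧
    a * b ^ z = g ^ x ∧ k + 2 * Nat.size z ≤ 2 * Nat.size x ∧ z ≤ l.length ∧ (0 < k ∨ z = x))
    ⟨1, g, x, rfl, h1, hg, by simp, by simp, by simp, Or.inr rfl⟩ ?_ ?_)
  · rintro i l _ K' k hK ⟨a, b, z, rfl, ha, hb, hab, hk, hz, hx⟩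
    refine Runs.ifEq (fun h0 => Runs.ret ⟨a, b, z, rfl, ha, hb, hab, hk, ?_, hx⟩) fun h0 => ?_
    · exact (show z = 0 from h0).trans_le (Nat.zero_le _)
    · replace h0 : z ≠ 0 := h0
      have hm : (if z % 2 = 1 then enc b else enc 1) = enc (b ^ (z % 2)) := by
        rcases Nat.mod_two_eq_zero_or_one z with h | h <;> simp [h]
      have hbm : b ^ (z % 2) ∈ K' := by
        rcases Nat.mod_two_eq_zero_or_one z with h | h
        · simpa [h] using hK h1
        · simpa [h] using hb
      change Runs enc K' (Prog.bind (Prog.mul (enc a) (if z % 2 = 1 then enc b else enc 1)) _) _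
      rw [hm]
      refine Runs.bind (Runs.mul ha hbm fun K₁ hK₁ h₁ _ =>
        Runs.bind (Runs.mul (hK₁ hb) (hK₁ hb) fun K₂ hK₂ h₂ _ => Runs.ret
          ⟨_, _, _, rfl, hK₂ h₁, h₂, ?_, ?_, ?_, Or.inl (by omega)⟩))
      · rw [← hab, ← pow_two, ← pow_mul, mul_assoc, ← pow_add, Nat.mod_add_div]
      · have := size_div_two h0
        change k + (1 + (1 + 0)) + 2 * Nat.size (z / 2) ≤ _
        omega
      · change z / 2 ≤ l.length
        rw [List.length_cons] at hz
        omega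
  · rintro _ K' k hK ⟨a, b, z, rfl, ha, hb, hab, hk, hz, hx⟩ _
    obtain rfl : z = 0 := by simpa using hz
    rw [pow_zero, mul_one] at hab
    subst hab
    refine Runs.ret ⟨rfl, ha, ?_, fun h => ?_⟩
    · simpa using hk
    · rcases hx with h' | h'
      · exact h'
      · omega

end Power

/-! ### Chains of iterated `p`-th powers -/

section Chain

variable {G : Type*} [CommGroup G] {p : ℕ} {enc : G ↪ ℕ} {K : Set G}

/-- The identifiers of the powers `g, g ^ p, g ^ p ^ 2, …` that are not the identity. -/
noncomputable def chainOf (p : ℕ) (enc : G ↪ ℕ) (g : G) : List ℕ :=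
  (List.range (height p g)).map fun i => enc (g ^ p ^ i)

@[simp]
theorem length_chainOf (g : G) : (chainOf p enc g).length = height p g := by simp [chainOf]

variable [hp : Fact p.Prime] (hG : IsPGroup p G)
include hG

theorem chainOf_getD (g : G) (i : ℕ) : (chainOf p enc g).getD i (enc 1) = enc (g ^ p ^ i) := by
  by_cases hi : i < height p g
  · simp [chainOf, List.getD_eq_getElem?_getD, hi]
  · rw [(pow_pow_eq_one_iff hG g i).2 (not_lt.1 hi), List.getD_eq_default]
    simpa using not_lt.1 hi

theorem runs_chain {g : G} (hg : g ∈ K) (h1 : (1 : G) ∈ K) {w : ℕ} (hw : 2 * Nat.size p ≤ w) :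
    Runs enc K (chain p (enc 1) (enc g)) fun c K' k =>
      c = chainOf p enc g ∧ (∀ i, g ^ p ^ i ∈ K') ∧ k ≤ height p g * w := by
  refine Runs.bind (Runs.iter (fun s K' k => ∃ i ≤ height p g,
      s = ((List.range i).map fun i => enc (g ^ p ^ i), enc (g ^ p ^ i)) ∧
      (∀ j ≤ i, g ^ p ^ j ∈ K') ∧ k ≤ i * w) (fun s => height p g - s.1.length)
      ⟨0, Nat.zero_le _, by simp, by simpa using hg, by simp⟩ ?_)
  rintro _ K' k hK ⟨i, hi, rfl, hmem, hk⟩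
  by_cases he : enc (g ^ p ^ i) = enc 1
  · have hi' : i = height p g :=
      le_antisymm hi ((pow_pow_eq_one_iff hG g i).1 (enc.injective he))
    refine Or.inl ⟨funext fun l => if_pos he, fun hK => Runs.ret ⟨?_, fun j => ?_, ?_⟩⟩
    · rw [hi', chainOf]
    · rcases le_or_gt j i with h | h
      · exact hmem j h
      · rw [(pow_pow_eq_one_iff hG g j).2 (by omega)]
        exact hK h1
    · rw [← hi']
      exact hk
  · have hi' : i < height p g := by
      refine lt_of_le_of_ne hi fun h => he ?_
      rw [(pow_pow_eq_one_iff hG g i).2 h.ge]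
    refine Or.inr (Runs.ifEq (fun h => absurd h he) fun _ => Runs.bind
      ((runs_power (hmem i le_rfl) (hK h1) p).mono ?_))
    rintro _ K'' k' hK' ⟨rfl, hmem', hk', hpos⟩ _
    refine Runs.ret ⟨hpos hp.out.pos, ?_, i + 1, hi', ?_, fun j hj => ?_, ?_⟩
    · simp only [List.length_append, List.length_map, List.length_range, List.length_singleton]
      omega
    · simp only [List.range_succ, List.map_append, List.map_cons, List.map_nil, pow_succ, pow_mul]
    · rcases Nat.le_succ_iff.1 hj with h | rfl
      · exact hK' (hmem j h)
      · rwa [pow_succ, pow_mul]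
    · rw [Nat.add_one_mul]
      omega

end Chain

/-! ### Tables of baby steps and giant steps -/

section Tables

variable {G : Type*} [CommGroup G] {p : ℕ} {enc : G ↪ ℕ} {K : Set G}

/-- The entries of the table `T` consist of the identifier of a known combination of `ws` and its
exponents, which are less than `p`. -/
def IsTable (enc : G ↪ ℕ) (p : ℕ) (K : Set G) (ws : List G) (T : List (ℕ × List ℕ)) : Prop :=
  ∀ t ∈ T, t.2.length = ws.length ∧ (∀ x ∈ t.2, x < p) ∧ comb ws t.2 ∈ K ∧ t.1 = enc (comb ws t.2)

theorem IsTable.mono {K' : Set G} {ws : List G} {T : List (ℕ × List ℕ)}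
    (h : IsTable enc p K ws T) (hK : K ⊆ K') : IsTable enc p K' ws T :=
  fun t ht => ⟨(h t ht).1, (h t ht).2.1, hK (h t ht).2.2.1, (h t ht).2.2.2⟩

theorem isTable_append {ws : List G} {T T' : List (ℕ × List ℕ)} :
    IsTable enc p K ws (T ++ T') ↔ IsTable enc p K ws T ∧ IsTable enc p K ws T' :=
  List.forall_mem_append

theorem comb_pow (ws : List G) (xs : List ℕ) (k : ℕ) :
    comb ws xs ^ k = comb (ws.map (· ^ k)) xs := by
  induction ws generalizing xs with
  | nil => simp [comb]
  | cons w ws ih => simp only [comb, List.map_cons, mul_pow, ih, ← pow_mul, mul_comm k]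

theorem comb_inv (ws : List G) (xs : List ℕ) :
    comb (ws.map (·⁻¹)) xs = (comb ws xs)⁻¹ := by
  induction ws generalizing xs with
  | nil => simp [comb]
  | cons w ws ih => simp [comb, ih, mul_comm]

/-- Each old entry starts its own run of `q` new ones; the first is the entry itself and costs
nothing, hence the count `k + T.length = T'.length`. -/
theorem runs_extend {ws : List G} {T : List (ℕ × List ℕ)} (hT : IsTable enc p K ws T) {w : G}
    {q inc : ℕ} (hq : 0 < q) (hw : w ^ inc ∈ K) (hinc : ∀ c < q, c * inc < p) :
    Runs enc K (extend T (enc (w ^ inc)) q inc) fun T' K' k =>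
      IsTable enc p K' (w :: ws) T' ∧ (∀ t ∈ T, ∀ c < q, ∃ t' ∈ T', t'.2 = c * inc :: t.2) ∧
        T'.length = q * T.length ∧ k + T.length = T'.length := by
  refine Runs.collect (fun l acc K' k => ∃ Td, T = Td ++ l ∧ IsTable enc p K' (w :: ws) acc ∧
    (∀ t ∈ Td, ∀ c < q, ∃ t' ∈ acc, t'.2 = c * inc :: t.2) ∧
      acc.length = q * Td.length ∧ k + Td.length = acc.length)
    ⟨[], rfl, by simp [IsTable], by simp, by simp, by simp⟩ ?_ ?_
  · rintro t l acc K' k hK ⟨Td, hTd, hacc, hcompl, hlen, hk⟩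
    obtain ⟨ht1, ht2, ht3, ht4⟩ := hT t (hTd ▸ by simp)
    refine Runs.bind (Runs.fold (fun r s K'' k' => ∃ c, s.2 = enc (comb (w :: ws) (c * inc :: t.2)) ∧
      comb (w :: ws) (c * inc :: t.2) ∈ K'' ∧ r = (List.range' c (q - 1 - c)) ∧ c ≤ q - 1 ∧
      IsTable enc p K'' (w :: ws) s.1 ∧ (∀ d ≤ c, ∃ t' ∈ s.1, t'.2 = d * inc :: t.2) ∧
      s.1.length = c + 1 ∧ k' = c) ?_ ?_ ?_)
    · have e : comb (w :: ws) (0 * inc :: t.2) = comb ws t.2 := by simp [comb]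
      refine ⟨0, by rw [e]; exact ht4, by rw [e]; exact hK ht3, ?_, Nat.zero_le _, ?_, ?_, rfl, rfl⟩
      · simp [List.range_eq_range']
      · intro t' ht'
        rw [List.mem_singleton] at ht'
        subst ht'
        rw [Nat.zero_mul] at e
        refine ⟨by simpa using ht1, ?_, by rw [e]; exact hK ht3, by rw [e]; exact ht4⟩
        intro x hx
        rcases List.mem_cons.1 hx with rfl | hx
        · simpa using hinc 0 hq
        · exact ht2 x hx
      · intro d hd
        obtain rfl : d = 0 := by omega
        exact ⟨_, List.mem_singleton_self _, by simp⟩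
    · rintro b r s K'' k' hK' ⟨c, hs, hmem, hr, hc, htab, hcov, hsl, rfl⟩
      have hcq : k' < q - 1 := by
        by_contra h
        rw [show q - 1 - k' = 0 by omega] at hr
        simp at hr
      rw [show q - 1 - k' = (q - 1 - (k' + 1)) + 1 by omega, List.range'_succ,
        List.cons.injEq] at hr
      obtain ⟨rfl, rfl⟩ := hr
      rw [hs]
      refine Runs.bind (Runs.mul hmem (hK' (hK hw)) fun K₁ hK₁ h₁ _ => Runs.ret ?_)
      have e : comb (w :: ws) (b * inc :: t.2) * w ^ inc =
          comb (w :: ws) ((b + 1) * inc :: t.2) := by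
        simp only [comb, List.headI_cons, List.tail_cons, Nat.add_one_mul, pow_add]
        exact mul_right_comm _ _ _
      rw [e] at h₁ ⊢
      refine ⟨b + 1, rfl, h₁, rfl, by omega, ?_, ?_, by simp [hsl], by omega⟩
      · refine isTable_append.2 ⟨htab.mono hK₁, ?_⟩
        intro t' ht'
        rw [List.mem_singleton] at ht'
        subst ht'
        refine ⟨by simpa using ht1, ?_, h₁, rfl⟩
        intro x hx
        rcases List.mem_cons.1 hx with rfl | hx
        · exact hinc _ (by omega)
        · exact ht2 x hx
      · intro d hd
        rcases Nat.le_succ_iff.1 hd with h | rfl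
        · obtain ⟨t', ht', h'⟩ := hcov d h
          exact ⟨t', List.mem_append_left _ ht', h'⟩
        · exact ⟨_, List.mem_append_right _ (List.mem_singleton_self _), rfl⟩
    · rintro s K'' k' hK' ⟨c, hs, hmem, hr, hc, htab, hcov, hsl, rfl⟩ _
      have hcq : k' = q - 1 := by
        have := congrArg List.length hr
        simp only [List.length_nil, List.length_range'] at this
        omega
      refine Runs.ret ⟨Td ++ [t], by simp [hTd], isTable_append.2 ⟨hacc.mono hK', htab⟩, ?_, ?_, ?_⟩
      · intro t' ht' c hc
        rcases List.mem_append.1 ht' with h | h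
        · obtain ⟨t₁, h1, h2⟩ := hcompl t' h c hc
          exact ⟨t₁, List.mem_append_left _ h1, h2⟩
        · rw [List.mem_singleton] at h
          subst h
          obtain ⟨t₁, h1, h2⟩ := hcov c (by omega)
          exact ⟨t₁, List.mem_append_right _ h1, h2⟩
      · simp only [List.length_append, List.length_singleton, Nat.mul_add, hlen, hsl]
        omega
      · simp only [List.length_append, List.length_singleton, ← hk, hsl]
        omega
  · rintro acc K' k hK ⟨Td, hTd, hacc, hcompl, hlen, hk⟩
    rw [List.append_nil] at hTd
    subst hTd
    exact ⟨hacc, hcompl, hlen, hk⟩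

/-- Tables of baby steps `T`, at most `L` many, and of giant steps `D` for `ws`. -/
structure AreTables (enc : G ↪ ℕ) (p : ℕ) (K : Set G) (ws : List G) (L : ℕ)
    (T D : List (ℕ × List ℕ)) : Prop where
  baby : IsTable enc p K (ws.map (·⁻¹)) T
  giant : IsTable enc p K ws D
  cover : ∀ fs : List ℕ, fs.length = ws.length → (∀ x ∈ fs, x < p) →
    ∃ t ∈ T, ∃ d ∈ D, comb ws t.2 * comb ws d.2 = comb ws fs
  length_baby : T.length ≤ L
  length_giant : D.length ≤ 1 ∨ D.length * (L + 1) ≤ 3 * p ^ ws.length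

theorem AreTables.mono {K' : Set G} {ws : List G} {L : ℕ} {T D : List (ℕ × List ℕ)}
    (h : AreTables enc p K ws L T D) (hK : K ⊆ K') : AreTables enc p K' ws L T D :=
  ⟨h.baby.mono hK, h.giant.mono hK, h.cover, h.length_baby, h.length_giant⟩

theorem areTables_nil (h1 : (1 : G) ∈ K) {L : ℕ} (hL : 0 < L) :
    AreTables enc p K ([] : List G) L [(enc 1, [])] [(enc 1, [])] where
  baby := by simpa [IsTable, comb] using h1
  giant := by simpa [IsTable, comb] using h1
  cover := by simp [comb]
  length_baby := hL
  length_giant := Or.inl le_rfl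

variable [hp : Fact p.Prime]

/-- Source of the factor `3`: in the expanded product, each of `(p - 1) / q * q`, `(p - 1) / q` and
`q` is less than `p`. -/
theorem giant_count_le {q : ℕ} (hq : q < p) : ((p - 1) / q + 1) * (q + 1) ≤ 3 * p := by
  have h1 : (p - 1) / q * q ≤ p - 1 := Nat.div_mul_le_self _ _
  have h2 : (p - 1) / q ≤ p - 1 := Nat.div_le_self _ _
  have := hp.out.pos
  calc ((p - 1) / q + 1) * (q + 1) = (p - 1) / q * q + (p - 1) / q + q + 1 := by ring
    _ ≤ 3 * p := by omega

variable (hG : IsPGroup p G)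
include hG

/-- The invariant concerns the processed part `Pd` and the remaining budget `M`. The size of the
baby table times `max 1 M` stays at most `L`. Either there is still a single giant step and `L + 1 ≤
p ^ |Pd| * (M + 1)`, which accounts for rounding in the divisions by `p`, or the budget is exhausted
and the bound on giant steps holds. -/
theorem runs_tables (P : List G) (h1 : (1 : G) ∈ K) (hP : ∀ g ∈ P, ∀ i, g ^ p ^ i ∈ K) {L w : ℕ}
    (hL : 0 < L) (hw : 2 * Nat.size p ≤ w) :
    Runs enc K (tables p (enc 1) L (P.map (chainOf p enc))) fun s K' k =>
      AreTables enc p K' (P.map (top p)) L s.1 s.2 ∧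
        k ≤ P.length * (2 * w) + s.1.length + s.2.length := by
  refine Runs.bind (Runs.fold (fun l s K' k => ∃ Pr Pd, P = Pr ++ Pd ∧
    l = (Pr.map (chainOf p enc)).reverse ∧
    IsTable enc p K' ((Pd.map (top p)).map (·⁻¹)) s.2.1 ∧ IsTable enc p K' (Pd.map (top p)) s.2.2 ∧
    (∀ fs : List ℕ, fs.length = Pd.length → (∀ x ∈ fs, x < p) →
      ∃ t ∈ s.2.1, ∃ d ∈ s.2.2, comb (Pd.map (top p)) t.2 * comb (Pd.map (top p)) d.2 =
        comb (Pd.map (top p)) fs) ∧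
    s.2.1.length * max 1 s.1 ≤ L ∧
    ((s.2.2.length = 1 ∧ 0 < s.1 ∧ L + 1 ≤ p ^ Pd.length * (s.1 + 1)) ∨
      (s.1 = 0 ∧ s.2.2.length * (L + 1) ≤ 3 * p ^ Pd.length)) ∧
    k + 2 ≤ Pd.length * (2 * w) + s.2.1.length + s.2.2.length) ?_ ?_ ?_)
  · refine ⟨P, [], by simp, rfl, ?_, ?_, by simp [comb], ?_, Or.inl ⟨rfl, hL, by simp⟩, by simp⟩
    · simpa [IsTable, comb] using h1
    · simpa [IsTable, comb] using h1
    · simp only [List.length_singleton]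
      omega
  · rintro c l ⟨M, T, D⟩ K' k hK ⟨Pr, Pd, hPP, hl, hT, hD, hcov, hTl, hDl, hk⟩
    dsimp only at hT hD hcov hTl hDl hk
    rcases List.eq_nil_or_concat Pr with rfl | ⟨Pr, g, rfl⟩
    · simp at hl
    simp only [List.concat_eq_append, List.map_append, List.map_cons, List.map_nil,
      List.reverse_append, List.reverse_cons, List.reverse_nil, List.nil_append,
      List.singleton_append, List.cons.injEq] at hl
    obtain ⟨rfl, rfl⟩ := hl
    have hget : (chainOf p enc g).getD ((chainOf p enc g).length - 1) (enc 1) = enc (top p g) := by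
      rw [length_chainOf, chainOf_getD hG, top]
    have hgP : g ∈ P := by rw [hPP]; simp
    have htop : top p g ∈ K' := hK (hP g hgP _)
    change Runs enc K' (Prog.bind (power (enc 1)
      ((chainOf p enc g).getD ((chainOf p enc g).length - 1) (enc 1)) (p - 1)) _) _
    rw [hget]
    set q := max 1 (min p M) with hq
    have hq0 : 0 < q := by omega
    have hqp : q ≤ p := by
      have := hp.out.one_lt
      omega
    have hsz : ∀ x ≤ p, 2 * Nat.size x ≤ w := fun x hx =>
      (Nat.mul_le_mul_left 2 (Nat.size_le_size hx)).trans hw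
    refine Runs.bind ((runs_power htop (hK h1) (p - 1)).mono ?_)
    rintro _ K₁ k₁ hK₁ ⟨rfl, hinv, hk₁, -⟩ -
    have hpinv : top p g ^ (p - 1) = (top p g)⁻¹ ^ 1 := by
      rw [pow_one, eq_inv_iff_mul_eq_one, ← pow_succ, Nat.sub_add_cancel hp.out.one_le, top_pow hG]
    rw [hpinv] at hinv ⊢
    refine Runs.bind ((runs_extend (hT.mono hK₁) hq0 hinv fun c hc => by omega).mono ?_)
    rintro T' K₂ k₂ hK₂ ⟨hT', hcT, hlT, hkT⟩ -
    refine Runs.bind ((runs_power (hK₂ (hK₁ htop)) (hK₂ (hK₁ (hK h1))) q).mono ?_)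
    rintro _ K₃ k₃ hK₃ ⟨rfl, hpow, hk₃, -⟩ -
    have hdq : ∀ c < (p - 1) / q + 1, c * q < p := fun c hc => by
      have h2 : c * q ≤ (p - 1) / q * q := Nat.mul_le_mul_right _ (by omega)
      have h3 := Nat.div_mul_le_self (p - 1) q
      have := hp.out.pos
      omega
    refine Runs.bind ((runs_extend (hD.mono (hK₁.trans (hK₂.trans hK₃))) (Nat.succ_pos _) hpow
      hdq).mono ?_)
    rintro D' K₄ k₄ hK₄ ⟨hD', hcD, hlD, hkD⟩ -
    refine Runs.ret ⟨Pr, g :: Pd, by simp [hPP], rfl, ?_, hD', ?_, ?_, ?_, ?_⟩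
    · exact hT'.mono (hK₃.trans hK₄)
    · intro fs hfs hfp
      rcases fs with _ | ⟨f, fs⟩
      · simp at hfs
      obtain ⟨t, ht, d, hd, htd⟩ := hcov fs (by simpa using hfs) fun x hx =>
        hfp x (List.mem_cons_of_mem _ hx)
      -- The exponent is split as `f = f % q + q * (f / q)` into a baby and a giant digit.
      obtain ⟨t', ht', et⟩ := hcT t ht (f % q) (Nat.mod_lt _ hq0)
      obtain ⟨d', hd', ed⟩ := hcD d hd (f / q) (Nat.lt_succ_of_le
        (Nat.div_le_div_right (Nat.le_sub_one_of_lt (hfp f List.mem_cons_self))))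
      refine ⟨t', ht', d', hd', ?_⟩
      simp only [et, ed, List.map_cons, comb, List.headI_cons, List.tail_cons, ← htd, mul_one]
      rw [mul_mul_mul_comm, ← pow_add, mul_comm (f / q), Nat.mod_add_div]
    · change T'.length * max 1 (M / p) ≤ L
      refine le_trans ?_ hTl
      rw [hlT, mul_comm q, mul_assoc]
      refine Nat.mul_le_mul_left _ ?_
      rcases lt_or_ge M p with h | h
      · rw [Nat.div_eq_of_lt h, max_eq_left zero_le_one, mul_one]
        omega
      · have h3 : 1 ≤ M / p := (Nat.one_le_div_iff hp.out.pos).2 h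
        have h4 := hp.out.one_le
        rw [max_eq_right h3, show q = p by omega, max_eq_right (h4.trans h)]
        exact Nat.mul_div_le M p
    · change (D'.length = 1 ∧ 0 < M / p ∧ L + 1 ≤ p ^ (g :: Pd).length * (M / p + 1)) ∨
        (M / p = 0 ∧ D'.length * (L + 1) ≤ 3 * p ^ (g :: Pd).length)
      rw [List.length_cons, pow_succ]
      -- If `0 < M < p`, this coordinate is split with `q = M`, and `giant_count_le` applies. If `p
      -- ≤ M`, then `q = p` and there is still one giant step. If `M = 0`, then `q = 1` and the
      -- giant table grows by the factor `p`.
      rcases hDl with ⟨hD1, hM, hLM⟩ | ⟨hM, hLM⟩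
      · rcases lt_or_ge M p with h | h
        · refine Or.inr ⟨Nat.div_eq_of_lt h, ?_⟩
          have hqM : q = M := by omega
          rw [hlD, hD1, hqM, mul_one]
          calc ((p - 1) / M + 1) * (L + 1)
              ≤ ((p - 1) / M + 1) * (p ^ Pd.length * (M + 1)) := Nat.mul_le_mul_left _ hLM
            _ = p ^ Pd.length * (((p - 1) / M + 1) * (M + 1)) := by ring
            _ ≤ p ^ Pd.length * (3 * p) := Nat.mul_le_mul_left _ (giant_count_le h)
            _ = 3 * (p ^ Pd.length * p) := by ring
        · have h3 : 1 ≤ M / p := (Nat.one_le_div_iff hp.out.pos).2 h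
          refine Or.inl ⟨?_, h3, ?_⟩
          · have hqp' : q = p := by
              have := hp.out.one_le
              omega
            rw [hlD, hD1, hqp', Nat.div_eq_of_lt (Nat.sub_one_lt hp.out.ne_zero)]
          · calc L + 1 ≤ p ^ Pd.length * (M + 1) := hLM
              _ ≤ p ^ Pd.length * (p * (M / p + 1)) :=
                Nat.mul_le_mul_left _ (Nat.lt_mul_div_succ M hp.out.pos)
              _ = p ^ Pd.length * p * (M / p + 1) := by ring
      · refine Or.inr ⟨by rw [hM]; simp, ?_⟩
        have hq1 : q = 1 := by omega
        rw [hlD, hq1, Nat.div_one, Nat.succ_eq_add_one, Nat.sub_add_cancel hp.out.one_le]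
        calc p * D.length * (L + 1) = p * (D.length * (L + 1)) := by ring
          _ ≤ p * (3 * p ^ Pd.length) := Nat.mul_le_mul_left _ hLM
          _ = 3 * (p ^ Pd.length * p) := by ring
    · change k + (k₁ + (k₂ + (k₃ + (k₄ + 0)))) + 2 ≤ (g :: Pd).length * (2 * w) + T'.length + D'.length
      have e1 := hsz (p - 1) (Nat.sub_le _ _)
      have e2 := hsz q hqp
      rw [List.length_cons, Nat.add_one_mul]
      omega
  · rintro ⟨M, T, D⟩ K' k hK ⟨Pr, Pd, hPP, hl, hT, hD, hcov, hTl, hDl, hk⟩ -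
    dsimp only at hT hD hcov hTl hDl hk
    obtain rfl : Pr = [] := by simpa using hl.symm
    rw [List.nil_append] at hPP
    subst hPP
    refine Runs.ret ⟨⟨hT, hD, ?_, ?_, ?_⟩, by dsimp only; omega⟩
    · intro fs hfs hfp
      exact hcov fs (by simpa using hfs) hfp
    · exact le_trans (Nat.le_mul_of_pos_right _ (by omega)) hTl
    · rw [List.length_map]
      rcases hDl with h | h
      · exact Or.inl h.1.le
      · exact Or.inr h.2

end Tables

/-! ### Finding and applying a relation -/

section Search

variable {G : Type*} [CommGroup G] {p : ℕ} {enc : G ↪ ℕ} {K : Set G}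

/-- The baby table holds inverses, so a relation is an equality between a baby step and `y` times a
giant step. Since `enc` is injective, comparing identifiers detects it, and only the products with
`y` are charged. -/
theorem runs_search {ws : List G} {L : ℕ} {T D : List (ℕ × List ℕ)}
    (hTD : AreTables enc p K ws L T D) {y : G} (hy : y ∈ K) :
    Runs enc K (search (enc y) T D) fun o _ k => k = D.length ∧
      (∀ xs ys, o = some (xs, ys) → y * (comb ws xs * comb ws ys) = 1 ∧
        (∀ x ∈ xs, x < p) ∧ ∀ x ∈ ys, x < p) ∧
      (o = none → ∀ fs : List ℕ, fs.length = ws.length → (∀ x ∈ fs, x < p) →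
        y * comb ws fs ≠ 1) := by
  refine Runs.bind (Runs.collect (fun l acc K' k => ∃ Dd, D = Dd ++ l ∧
    acc = Dd.map (fun d => (enc (y * comb ws d.2), d.2)) ∧ k = Dd.length)
    ⟨[], rfl, rfl, rfl⟩ ?_ ?_)
  · rintro d l acc K' k hK ⟨Dd, hD, rfl, rfl⟩
    obtain ⟨-, -, hd, he⟩ := hTD.giant d (by rw [hD]; simp)
    rw [he]
    exact Runs.bind (Runs.mul (hK hy) (hK hd) fun K₁ hK₁ h₁ _ => Runs.ret
      ⟨Dd ++ [d], by simp [hD], by simp, by simp⟩)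
  · rintro _ K' k hK ⟨Dd, hD, rfl, rfl⟩ -
    rw [List.append_nil] at hD
    subst hD
    refine Runs.ret ⟨rfl, fun xs ys ho => ?_, fun ho fs hfs hfp hy => ?_⟩
    · have hm := List.mem_of_mem_head? ho
      simp only [List.mem_flatMap, List.mem_map, List.mem_ite_nil_right, List.mem_singleton,
        exists_exists_and_eq_and] at hm
      obtain ⟨d, hd, t, ht, he, hxy⟩ := hm
      simp only [Prod.mk.injEq] at hxy
      obtain ⟨rfl, rfl⟩ := hxy
      obtain ⟨-, h2, -, h4⟩ := hTD.baby t ht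
      obtain ⟨-, h5, -, -⟩ := hTD.giant d hd
      refine ⟨?_, h2, h5⟩
      rw [h4, comb_inv] at he
      rw [← eq_inv_iff_mul_eq_one.1 (enc.injective he).symm]
      rw [mul_comm (comb ws t.2), mul_assoc]
    · obtain ⟨t, ht, d, hd, htd⟩ := hTD.cover fs hfs hfp
      have hnil := List.head?_eq_none_iff.1 ho
      simp only [List.flatMap_eq_nil_iff, List.mem_map, forall_exists_index, and_imp,
        forall_apply_eq_imp_iff₂] at hnil
      have h3 := hnil d hd t ht
      rw [if_pos] at h3
      · simp at h3
      · rw [(hTD.baby t ht).2.2.2, comb_inv]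
        congr 1
        rw [← htd, mul_comm (comb ws t.2), ← mul_assoc, mul_eq_one_iff_eq_inv] at hy
        exact hy.symm

variable [hp : Fact p.Prime] (hG : IsPGroup p G)
include hG

/-- The exponents of the baby step and the giant step are added before taking powers; their sums are
below `2 * p`, which explains the hypothesis on `w`. -/
theorem runs_reduce (P : List G) (h1 : (1 : G) ∈ K) (hP : ∀ g ∈ P, ∀ i, g ^ p ^ i ∈ K) {a w : ℕ}
    (hw : 2 * Nat.size (2 * p) ≤ w) {u : G} (hu : u ∈ K) {xs ys : List ℕ}
    (hxs : ∀ x ∈ xs, x < p) (hys : ∀ x ∈ ys, x < p) :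
    Runs enc K (reduce (enc 1) a (enc u) (P.map (chainOf p enc)) xs ys) fun y K' k =>
      ∃ h : G, y = enc (u * h) ∧ u * h ∈ K' ∧ k ≤ P.length * (w + 1) ∧
        h = comb (P.map fun g => g ^ p ^ (height p g - a)) xs *
          comb (P.map fun g => g ^ p ^ (height p g - a)) ys := by
  set φ : G → G := fun g => g ^ p ^ (height p g - a)
  refine Runs.bind (Runs.fold (fun l s K' k => ∃ Pr z, l = Pr.map (chainOf p enc) ∧
    (∀ g ∈ Pr, g ∈ P) ∧ s.1 = enc z ∧ z ∈ K' ∧ (∀ x ∈ s.2.1, x < p) ∧ (∀ x ∈ s.2.2, x < p) ∧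
    z * (comb (Pr.map φ) s.2.1 * comb (Pr.map φ) s.2.2) =
      u * (comb (P.map φ) xs * comb (P.map φ) ys) ∧
    k + Pr.length * (w + 1) ≤ P.length * (w + 1))
    ⟨P, u, rfl, fun _ h => h, rfl, hu, hxs, hys, rfl, by simp⟩ ?_ ?_)
  · rintro c l ⟨i, xs', ys'⟩ K' k hK ⟨Pr, z, hl, hPr, hi, hz, hx, hy, hprod, hk⟩
    dsimp only at hi hx hy hprod
    subst hi
    rcases Pr with _ | ⟨g, Pr⟩
    · simp at hl
    obtain ⟨rfl, rfl⟩ := by simpa using hl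
    have hget : (chainOf p enc g).getD ((chainOf p enc g).length - a) (enc 1) = enc (φ g) := by
      rw [length_chainOf, chainOf_getD hG]
    change Runs enc K' (Prog.bind (power (enc 1)
      ((chainOf p enc g).getD ((chainOf p enc g).length - a) (enc 1)) (xs'.headI + ys'.headI)) _) _
    rw [hget]
    have hhead : ∀ l : List ℕ, (∀ x ∈ l, x < p) → l.headI < p := by
      intro l hl
      rcases l with _ | ⟨x, l⟩
      · exact hp.out.pos
      · exact hl x List.mem_cons_self
    refine Runs.bind ((runs_power (hK (hP g (hPr g List.mem_cons_self) _)) (hK h1) _).mono ?_)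
    rintro _ K₁ k₁ hK₁ ⟨rfl, hpow, hk₁, -⟩ -
    refine Runs.bind (Runs.mul (hK₁ hz) hpow fun K₂ hK₂ h₂ _ => Runs.ret
      ⟨Pr, _, rfl, fun h hh => hPr h (List.mem_cons_of_mem _ hh), rfl, h₂,
        fun x h => hx x (List.mem_of_mem_tail h), fun x h => hy x (List.mem_of_mem_tail h), ?_, ?_⟩)
    · rw [← hprod]
      simp only [List.map_cons, comb]
      rw [mul_mul_mul_comm (φ g ^ xs'.headI), ← pow_add, mul_assoc]
    · have h3 : 2 * Nat.size (xs'.headI + ys'.headI) ≤ w := le_trans (Nat.mul_le_mul_left 2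
        (Nat.size_le_size (by have := hhead xs' hx; have := hhead ys' hy; omega))) hw
      rw [List.length_cons, Nat.add_one_mul] at hk
      omega
  · rintro ⟨i, xs', ys'⟩ K' k hK ⟨Pr, z, hl, hPr, hi, hz, hx, hy, hprod, hk⟩ -
    dsimp only at hi hx hy hprod
    subst hi
    obtain rfl : Pr = [] := by simpa using hl.symm
    simp only [List.map_nil, comb, mul_one] at hprod
    refine Runs.ret ⟨_, ?_, ?_, by simpa using hk, rfl⟩
    · rw [← hprod]
    · rwa [← hprod]

end Search

/-! ### Cost functions -/

section Cost

/-- The square root of `p ^ v`. -/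
noncomputable def sqrtPow (p v : ℕ) : ℝ := (p : ℝ) ^ ((v : ℝ) / 2)

theorem sqrtPow_nonneg (p v : ℕ) : 0 ≤ sqrtPow p v := Real.rpow_nonneg (Nat.cast_nonneg p) _

theorem sqrtPow_sq (p v : ℕ) : sqrtPow p v ^ 2 = (p : ℝ) ^ v := by
  rw [sqrtPow, ← Real.rpow_natCast, ← Real.rpow_mul (Nat.cast_nonneg p), Nat.cast_ofNat,
    div_mul_cancel₀ _ two_ne_zero, Real.rpow_natCast]

theorem sqrtPow_pos {p : ℕ} (hp : 0 < p) (v : ℕ) : 0 < sqrtPow p v :=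
  Real.rpow_pos_of_pos (Nat.cast_pos.2 hp) _

theorem sqrtPow_mono {p : ℕ} (hp : 0 < p) {v v' : ℕ} (h : v ≤ v') :
    sqrtPow p v ≤ sqrtPow p v' := by
  refine Real.rpow_le_rpow_of_exponent_le (by exact_mod_cast hp) ?_
  have : (v : ℝ) ≤ v' := by exact_mod_cast h
  linarith

theorem nat_sqrt_le_sqrtPow (p v : ℕ) : (Nat.sqrt (p ^ v) : ℝ) ≤ sqrtPow p v := by
  refine le_of_sq_le_sq ?_ (sqrtPow_nonneg p v)
  rw [sqrtPow_sq]
  exact_mod_cast Nat.sqrt_le' (p ^ v)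

theorem sqrtPow_le_nat_sqrt (p v : ℕ) : sqrtPow p v ≤ Nat.sqrt (p ^ v) + 1 := by
  refine le_of_sq_le_sq ?_ (by positivity)
  rw [sqrtPow_sq]
  exact_mod_cast (Nat.lt_succ_sqrt' (p ^ v)).le

/-- The bound on the number of baby steps for a subspace of dimension `v`. -/
def babySize (p n v : ℕ) : ℕ := (n + 1 - v) * (Nat.sqrt (p ^ v) + 1)

/-- A bound on the cost of replacing an element of order `p ^ (j + 1)`, where `r` is the rank of the
group of `p ^ j`-th powers and `m` bounds all heights. -/
noncomputable def reduceCost (p n w m r : ℕ) : ℝ :=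
  3 * sqrtPow p r / (n + 1 - r : ℕ) + 1 + n * (w + 1) + m * w

/-- A bound on the cost of adding an element to an independent family of `v` elements. -/
noncomputable def addCost (p n w v : ℕ) : ℝ :=
  3 * sqrtPow p v + 1 + (v + 1) * (2 * w) + babySize p n (v + 1) + (3 * sqrtPow p (v + 1) + 1)

theorem reduceCost_nonneg (p n w m r : ℕ) : 0 ≤ reduceCost p n w m r := by
  have := sqrtPow_nonneg p r
  unfold reduceCost
  positivity

theorem addCost_nonneg (p n w v : ℕ) : 0 ≤ addCost p n w v := by
  have := sqrtPow_nonneg p v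
  have := sqrtPow_nonneg p (v + 1)
  unfold addCost
  positivity

/-- The number of baby steps allowed is at least `(n + 1 - v) * p ^ (v / 2)`; one factor `p ^ (v /
2)` cancels in the bound `3 * p ^ v`. -/
theorem giant_length_le {p n v d : ℕ} (hp : 0 < p) (hv : v ≤ n)
    (h : d ≤ 1 ∨ d * (babySize p n v + 1) ≤ 3 * p ^ v) :
    (d : ℝ) ≤ 3 * sqrtPow p v / (n + 1 - v : ℕ) + 1 := by
  have hs := sqrtPow_pos hp v
  have hB : (0 : ℝ) < (n + 1 - v : ℕ) := by
    exact_mod_cast (by omega : 0 < n + 1 - v)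
  rcases h with h | h
  · have : (d : ℝ) ≤ 1 := by exact_mod_cast h
    have : 0 ≤ 3 * sqrtPow p v / (n + 1 - v : ℕ) := by positivity
    linarith
  · have h1 : (d : ℝ) * ((n + 1 - v : ℕ) * (Nat.sqrt (p ^ v) + 1) + 1) ≤ 3 * sqrtPow p v ^ 2 := by
      rw [sqrtPow_sq]
      exact_mod_cast h
    have h2 : (d : ℝ) * ((n + 1 - v : ℕ) * sqrtPow p v) ≤ 3 * sqrtPow p v ^ 2 := by
      refine le_trans (mul_le_mul_of_nonneg_left ?_ (Nat.cast_nonneg d)) h1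
      have := mul_le_mul_of_nonneg_left (sqrtPow_le_nat_sqrt p v) hB.le
      linarith
    have h3 : (d : ℝ) ≤ 3 * sqrtPow p v / (n + 1 - v : ℕ) := by
      rw [le_div_iff₀ hB]
      refine le_of_mul_le_mul_right ?_ hs
      linarith
    linarith

end Cost

/-! ### The main loop and its amortized cost -/

section Loop

/-- The number of elements of height greater than `j` in three lists. -/
noncomputable def heightCount {G : Type*} [CommGroup G] (p : ℕ) (P U l : List G) (j : ℕ) : ℕ :=
  (P ++ U ++ l).countP fun g => j < height p g

theorem heightCount_le_length {G : Type*} [CommGroup G] {p : ℕ} (P U l : List G) (j : ℕ) :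
    heightCount p P U l j ≤ P.length + U.length + l.length := by
  refine List.countP_le_length.trans ?_
  simp [add_assoc]

theorem comb_mem {G : Type*} [CommGroup G] {H : Subgroup G} {ws : List G} (h : ∀ w ∈ ws, w ∈ H) (xs : List ℕ) :
    comb ws xs ∈ H := by
  induction ws generalizing xs with
  | nil => exact H.one_mem
  | cons w ws ih =>
    exact H.mul_mem (H.pow_mem (h w List.mem_cons_self) _)
      (ih (fun w hw => h w (List.mem_cons_of_mem _ hw)) _)

variable {G : Type*} [CommGroup G] [Finite G] {p : ℕ} {enc : G ↪ ℕ} {K : Set G}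

/-- A bound on the number of multiplications that are still needed. -/
noncomputable def potential (p n w m : ℕ) (P U l : List G) : ℝ :=
  ∑ j ∈ Finset.range m, ((heightCount p P U l j : ℝ) - powRank p G j) *
      reduceCost p n w m (powRank p G j) +
    ∑ v ∈ Finset.Ico P.length (powRank p G 0), addCost p n w v

/-- The invariant of the algorithm: `P` is the independent family, the elements of `U` have been
processed at level `a`, and those of `l` have not. -/
structure Invariant (enc : G ↪ ℕ) (p n w m : ℕ) (B : ℝ) (K : Set G) (a : ℕ) (P U l : List G)
    (T D : List (ℕ × List ℕ)) (k : ℕ) : Prop where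
  known : ∀ g ∈ P ++ U ++ l, ∀ i, g ^ p ^ i ∈ K
  closure : Subgroup.closure {g | g ∈ P ++ U ++ l} = ⊤
  length : P.length + U.length + l.length = n
  indep : Indep p (P.map (top p))
  height_pos : ∀ g ∈ P, 0 < height p g
  height_left : ∀ g ∈ P, a ≤ height p g
  height_mid : ∀ g ∈ U, height p g < a
  height_right : ∀ g ∈ l, height p g ≤ a
  tables : AreTables enc p K (P.map (top p)) (babySize p n P.length) T D
  cost : k + potential p n w m P U l ≤ B

variable {n w m a k : ℕ} {B : ℝ} {P U l : List G} {T D : List (ℕ × List ℕ)}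

theorem Invariant.skip {u : G} (h : Invariant enc p n w m B K a P U (u :: l) T D k)
    (hu : height p u < a) : Invariant enc p n w m B K a P (u :: U) l T D k := by
  have hmem : ∀ g, g ∈ P ++ (u :: U) ++ l ↔ g ∈ P ++ U ++ u :: l := by
    intro g
    simp only [List.mem_append, List.mem_cons]
    tauto
  refine ⟨fun g hg => h.known g ((hmem g).1 hg), ?_, ?_, h.indep, h.height_pos, h.height_left, ?_,
    fun g hg => h.height_right g (List.mem_cons_of_mem _ hg), h.tables, ?_⟩
  · simp only [hmem]
    exact h.closure
  · have := h.length
    simp only [List.length_cons] at this ⊢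
    omega
  · intro g hg
    rcases List.mem_cons.1 hg with rfl | hg
    · exact hu
    · exact h.height_mid g hg
  · have : heightCount p P (u :: U) l = heightCount p P U (u :: l) := by
      funext j
      simp only [heightCount, List.countP_append, List.countP_cons]
      omega
    have h2 := h.cost
    rwa [potential, ← this] at h2

theorem Invariant.next (h : Invariant enc p n w m B K (a + 1) P U [] T D k) :
    Invariant enc p n w m B K a P [] U T D k := by
  refine ⟨by simpa using h.known, by simpa using h.closure, by simpa using h.length, h.indep,
    h.height_pos, fun g hg => (Nat.le_succ a).trans (h.height_left g hg), by simp,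
    fun g hg => Nat.le_of_lt_succ (h.height_mid g hg), h.tables, ?_⟩
  have h2 := h.cost
  rw [potential] at h2 ⊢
  simpa [heightCount] using h2

variable [hp : Fact p.Prime] (hG : IsPGroup p G)
include hG

/-- Pays with the summand `v = |P|` of the potential. That summand is present because the enlarged
family is still independent, so `|P|` is less than the rank of `G`. The height counts do not change.
-/
theorem Invariant.add {u : G} (h : Invariant enc p n w m B K a P U (u :: l) T D k)
    (hu : height p u = a) (ha : 0 < a)
    (hno : ∀ fs : List ℕ, fs.length = (P.map (top p)).length → (∀ x ∈ fs, x < p) →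
      top p u * comb (P.map (top p)) fs ≠ 1) {K' : Set G} (hK : K ⊆ K')
    {T' D' : List (ℕ × List ℕ)}
    (hT : AreTables enc p K' ((u :: P).map (top p)) (babySize p n (u :: P).length) T' D') {k' : ℕ}
    (hk' : k' ≤ D.length + ((u :: P).length * (2 * w) + T'.length + D'.length)) :
    Invariant enc p n w m B K' a (u :: P) U l T' D' (k + k') := by
  have hmem : ∀ g, g ∈ (u :: P) ++ U ++ l ↔ g ∈ P ++ U ++ u :: l := by
    intro g
    simp only [List.mem_append, List.mem_cons]
    tauto
  have hind : Indep p ((u :: P).map (top p)) := by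
    rw [List.map_cons]
    refine h.indep.cons (top_pow hG u) ?_ hno
    intro w hw
    obtain ⟨g, -, rfl⟩ := List.mem_map.1 hw
    exact top_pow hG g
  have hpos : ∀ g ∈ u :: P, 0 < height p g := by
    intro g hg
    rcases List.mem_cons.1 hg with rfl | hg
    · exact hu ▸ ha
    · exact h.height_pos g hg
  have hlen := h.length
  rw [List.length_cons] at hlen
  refine ⟨fun g hg i => hK (h.known g ((hmem g).1 hg) i), ?_, ?_, hind, hpos, ?_, h.height_mid,
    fun g hg => h.height_right g (List.mem_cons_of_mem _ hg), hT, ?_⟩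
  · simp only [hmem]
    exact h.closure
  · rw [List.length_cons]
    omega
  · intro g hg
    rcases List.mem_cons.1 hg with rfl | hg
    · exact hu.ge
    · exact h.height_left g hg
  · have hcount : heightCount p (u :: P) U l = heightCount p P U (u :: l) := by
      funext j
      simp only [heightCount, List.countP_append, List.countP_cons]
      omega
    have hr : P.length < powRank p G 0 := length_le_powRank hG hind hpos
    have h2 := h.cost
    rw [potential, Finset.sum_eq_sum_Ico_succ_bot hr, ← hcount] at h2
    rw [potential, List.length_cons]
    have htl := h.tables.length_giant
    rw [List.length_map] at htl
    have hd := giant_length_le hp.out.pos (by omega) htl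
    have htl' := hT.length_giant
    rw [List.length_map] at htl'
    have hd' := giant_length_le hp.out.pos (by rw [List.length_cons]; omega) htl'
    have ht' : (T'.length : ℝ) ≤ babySize p n (P.length + 1) := by exact_mod_cast hT.length_baby
    have hdiv : ∀ v ≤ n, 3 * sqrtPow p v / (n + 1 - v : ℕ) ≤ 3 * sqrtPow p v := by
      intro v hv
      refine div_le_self (by have := sqrtPow_nonneg p v; positivity) ?_
      exact_mod_cast (by omega : 1 ≤ n + 1 - v)
    have e1 := hdiv P.length (by omega)
    have e2 := hdiv (P.length + 1) (by omega)
    have e3 : (k' : ℝ) ≤ D.length + ((P.length + 1) * (2 * w) + T'.length + D'.length) := by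
      exact_mod_cast hk'
    rw [List.length_cons] at hd'
    rw [addCost] at h2
    push_cast
    linarith

/-- Pays with one unit of the height count at `j = a - 1`: `u` is counted there and `u * h₀` is not,
and no other count increases. The generated group is unchanged because `h₀` lies in the span of `P`.
-/
theorem Invariant.reduce {u h₀ : G} (h : Invariant enc p n w m B K a P U (u :: l) T D k)
    (hu : height p u = a) (ha : 0 < a) (ham : a ≤ m) (hh : h₀ ∈ Subgroup.closure {g | g ∈ P})
    (hlt : height p (u * h₀) < a) {K' : Set G} (hK : K ⊆ K')
    (hmem : ∀ i, (u * h₀) ^ p ^ i ∈ K') {k' : ℕ}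
    (hk' : k' ≤ D.length + (P.length * (w + 1) + m * w)) :
    Invariant enc p n w m B K' a P ((u * h₀) :: U) l T D (k + k') := by
  have hlen := h.length
  rw [List.length_cons] at hlen
  have hcl : Subgroup.closure {g | g ∈ P ++ ((u * h₀) :: U) ++ l} = ⊤ := by
    rw [eq_top_iff, ← h.closure, Subgroup.closure_le]
    intro g hg
    simp only [List.mem_append, List.mem_cons, Set.mem_ofPred_eq] at hg
    have hsub : ∀ g, g ∈ P ++ ((u * h₀) :: U) ++ l →
        g ∈ Subgroup.closure {g | g ∈ P ++ ((u * h₀) :: U) ++ l} :=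
      fun g hg => Subgroup.subset_closure hg
    rcases hg with (hg | hg) | rfl | hg
    · exact hsub g (by simp [hg])
    · exact hsub g (by simp [hg])
    · have h1 := hsub (g * h₀) (by simp)
      have h2 : h₀ ∈ Subgroup.closure {x | x ∈ P ++ ((g * h₀) :: U) ++ l} :=
        Subgroup.closure_mono (fun x (hx : x ∈ P) => by simp [hx]) hh
      simpa using mul_mem h1 (inv_mem h2)
    · exact hsub g (by simp [hg])
  refine ⟨?_, hcl, ?_, h.indep, h.height_pos, h.height_left, ?_,
    fun g hg => h.height_right g (List.mem_cons_of_mem _ hg), h.tables.mono hK, ?_⟩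
  · intro g hg i
    simp only [List.mem_append, List.mem_cons] at hg
    rcases hg with (hg | rfl | hg) | hg
    · exact hK (h.known g (by simp [hg]) i)
    · exact hmem i
    · exact hK (h.known g (by simp [hg]) i)
    · exact hK (h.known g (by simp [hg]) i)
  · rw [List.length_cons]
    omega
  · intro g hg
    rcases List.mem_cons.1 hg with rfl | hg
    · exact hlt
    · exact h.height_mid g hg
  · obtain ⟨j, rfl⟩ : ∃ j, a = j + 1 := ⟨a - 1, by omega⟩
    have hmono : ∀ i, heightCount p P ((u * h₀) :: U) l i ≤ heightCount p P U (u :: l) i := by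
      intro i
      simp only [heightCount, List.countP_append, List.countP_cons, decide_eq_true_eq]
      split_ifs <;> omega
    have hstrict : heightCount p P ((u * h₀) :: U) l j + 1 ≤ heightCount p P U (u :: l) j := by
      simp only [heightCount, List.countP_append, List.countP_cons, decide_eq_true_eq]
      split_ifs <;> omega
    have hsum : ∑ i ∈ Finset.range m, ((heightCount p P ((u * h₀) :: U) l i : ℝ) - powRank p G i) *
          reduceCost p n w m (powRank p G i) + reduceCost p n w m (powRank p G j) ≤
        ∑ i ∈ Finset.range m, ((heightCount p P U (u :: l) i : ℝ) - powRank p G i) *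
          reduceCost p n w m (powRank p G i) := by
      rw [← Finset.sum_erase_add _ _ (Finset.mem_range.2 (Nat.lt_of_succ_le ham)),
        ← Finset.sum_erase_add (Finset.range m) _ (Finset.mem_range.2 (Nat.lt_of_succ_le ham)),
        add_assoc]
      refine add_le_add (Finset.sum_le_sum fun i _ => ?_) ?_
      · refine mul_le_mul_of_nonneg_right ?_ (reduceCost_nonneg _ _ _ _ _)
        have : (heightCount p P ((u * h₀) :: U) l i : ℝ) ≤ heightCount p P U (u :: l) i := by
          exact_mod_cast hmono i
        linarith
      · have h1 : (heightCount p P ((u * h₀) :: U) l j : ℝ) + 1 ≤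
            heightCount p P U (u :: l) j := by exact_mod_cast hstrict
        have h2 := reduceCost_nonneg p n w m (powRank p G j)
        nlinarith
    have h2 := h.cost
    rw [potential] at h2 ⊢
    have hv : P.length ≤ powRank p G j :=
      length_le_powRank hG h.indep fun g hg => h.height_left g hg
    have hrn : powRank p G j ≤ n := by
      refine (powRank_le_countP hG hcl j).trans (List.countP_le_length.trans ?_)
      simp only [List.length_append, List.length_cons]
      omega
    have htl := h.tables.length_giant
    rw [List.length_map] at htl
    have hd := giant_length_le hp.out.pos (by omega) htl
    -- The search takes place in dimension `|P| ≤ r_j`, and `p ^ (v / 2) / (n + 1 - v)` increases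
    -- with `v`.
    have hd2 : 3 * sqrtPow p P.length / (n + 1 - P.length : ℕ) ≤
        3 * sqrtPow p (powRank p G j) / (n + 1 - powRank p G j : ℕ) := by
      refine div_le_div₀ ?_ ?_ ?_ ?_
      · have := sqrtPow_nonneg p (powRank p G j)
        positivity
      · have := sqrtPow_mono hp.out.pos hv
        linarith
      · exact_mod_cast (by omega : 0 < n + 1 - powRank p G j)
      · exact_mod_cast (by omega : n + 1 - powRank p G j ≤ n + 1 - P.length)
    have e3 : (k' : ℝ) ≤ D.length + (P.length * (w + 1) + m * w) := by exact_mod_cast hk'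
    have e4 : (P.length : ℝ) * (w + 1) ≤ n * (w + 1) := by
      have : (P.length : ℝ) ≤ n := by exact_mod_cast (by omega : P.length ≤ n)
      exact mul_le_mul_of_nonneg_right this (by positivity)
    rw [reduceCost] at hsum
    push_cast
    linarith

theorem runs_levelStep {u : G} (hw : 2 * Nat.size (2 * p) ≤ w) (hm : ∀ g : G, height p g ≤ m)
    (h1 : (1 : G) ∈ K) (ha : 0 < a) (h : Invariant enc p n w m B K a P U (u :: l) T D k) :
    Runs enc K (levelStep p (enc 1) n a (P.map (chainOf p enc), U.map (chainOf p enc), T, D)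
      (chainOf p enc u)) fun s K' k' => ∃ P' U' T' D',
        s = (P'.map (chainOf p enc), U'.map (chainOf p enc), T', D') ∧
          Invariant enc p n w m B K' a P' U' l T' D' (k + k') := by
  have hknown := h.known
  simp only [List.mem_append, List.mem_cons] at hknown
  refine Runs.ifEq (fun hu => ?_) fun hu => ?_
  · rw [length_chainOf] at hu
    have hget : (chainOf p enc u).getD ((chainOf p enc u).length - 1) (enc 1) = enc (top p u) := by
      rw [length_chainOf, chainOf_getD hG, top]
    rw [hget]
    refine Runs.bind ((runs_search h.tables (hknown u (by simp) _)).mono ?_)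
    rintro o K₁ k₁ hK₁ ⟨rfl, hsome, hnone⟩ -
    rcases o with _ | ⟨xs, ys⟩
    · refine Runs.cases_none ?_
      change Runs enc K₁ (Prog.bind (tables p (enc 1) ((n - (P.map (chainOf p enc)).length) *
        (Nat.sqrt (p ^ ((P.map (chainOf p enc)).length + 1)) + 1))
          ((u :: P).map (chainOf p enc))) _) _
      -- With `v = |P| + 1`, the factor `n + 1 - v` of `babySize` is `n - |P|`.
      have hL : (n - (P.map (chainOf p enc)).length) *
          (Nat.sqrt (p ^ ((P.map (chainOf p enc)).length + 1)) + 1) =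
            babySize p n (u :: P).length := by
        rw [babySize, List.length_map, List.length_cons, Nat.add_sub_add_right]
      have hlen := h.length
      rw [List.length_cons] at hlen
      rw [hL]
      refine Runs.bind ((runs_tables hG (u :: P) (hK₁ h1) (fun g hg i => hK₁ (hknown g ?_ i))
        (Nat.mul_pos ?_ (Nat.succ_pos _)) (le_trans (Nat.mul_le_mul_left 2 (Nat.size_le_size
          (Nat.le_mul_of_pos_left _ two_pos))) hw)).mono ?_)
      · rcases List.mem_cons.1 hg with hg | hg <;> simp [hg]
      · rw [List.length_cons]
        omega
      · rintro ⟨T', D'⟩ K₂ k₂ hK₂ ⟨hT, hk₂⟩ -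
        refine Runs.ret ⟨u :: P, U, T', D', rfl, h.add hG hu ha (hnone rfl) (hK₁.trans hK₂) hT ?_⟩
        dsimp only at hk₂ ⊢
        omega
    · obtain ⟨hrel, hxs, hys⟩ := hsome xs ys rfl
      have hget0 : (chainOf p enc u).getD 0 (enc 1) = enc u := by
        rw [chainOf_getD hG, pow_zero, pow_one]
      refine Runs.cases_some ?_
      change Runs enc K₁ (Prog.bind (BasisAlgorithm.reduce (enc 1) a
        ((chainOf p enc u).getD 0 (enc 1)) (P.map (chainOf p enc)) xs ys) _) _
      rw [hget0]
      have hu0 : u ∈ K := by simpa using hknown u (by simp) 0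
      refine Runs.bind ((runs_reduce hG P (hK₁ h1) (fun g hg i => hK₁ (hknown g (by simp [hg]) i))
        hw (hK₁ hu0) hxs hys).mono ?_)
      rintro _ K₂ k₂ hK₂ ⟨h₀, rfl, hmem, hk₂, hh₀⟩ -
      refine Runs.bind ((runs_chain hG hmem (hK₂ (hK₁ h1)) (le_trans (Nat.mul_le_mul_left 2
        (Nat.size_le_size (Nat.le_mul_of_pos_left _ two_pos))) hw)).mono ?_)
      rintro _ K₃ k₃ hK₃ ⟨rfl, hmem', hk₃⟩ -
      refine Runs.ret ⟨P, (u * h₀) :: U, T, D, rfl, h.reduce hG hu ha (hu ▸ hm u) ?_ ?_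
        (hK₁.trans (hK₂.trans hK₃)) hmem' ?_⟩
      · rw [hh₀]
        refine mul_mem (comb_mem ?_ _) (comb_mem ?_ _) <;>
        · intro x hx
          obtain ⟨g, hg, rfl⟩ := List.mem_map.1 hx
          exact pow_mem (Subgroup.subset_closure (show g ∈ {g | g ∈ P} from hg)) _
      · have htops : List.map (fun g : G => g ^ p ^ (a - 1))
            (P.map fun g => g ^ p ^ (height p g - a)) = P.map (top p) := by
          rw [List.map_map]
          refine List.map_congr_left fun g hg => ?_
          have := h.height_left g hg
          simp only [Function.comp, ← pow_mul, ← pow_add, top]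
          congr 2
          omega
        have h3 : (u * h₀) ^ p ^ (a - 1) = 1 := by
          rw [hh₀, mul_pow, mul_pow, comb_pow, comb_pow, htops, ← hrel, hu]
        have := (pow_pow_eq_one_iff hG _ _).1 h3
        omega
      · have : height p (u * h₀) * w ≤ m * w := Nat.mul_le_mul_right _ (hm _)
        omega
  · rw [length_chainOf] at hu
    refine Runs.ret ⟨P, u :: U, T, D, rfl, ?_⟩
    have hle := h.height_right u List.mem_cons_self
    exact h.skip (by omega)

theorem runs_level (hw : 2 * Nat.size (2 * p) ≤ w) (hm : ∀ g : G, height p g ≤ m)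
    (h1 : (1 : G) ∈ K) (h : Invariant enc p n w m B K (a + 1) P [] U T D k) :
    Runs enc K (level p (enc 1) n (a + 1) (P.map (chainOf p enc), U.map (chainOf p enc), T, D))
      fun s K' k' => ∃ P' U' T' D',
        s = (P'.map (chainOf p enc), U'.map (chainOf p enc), T', D') ∧
          Invariant enc p n w m B K' a P' [] U' T' D' (k + k') := by
  refine Runs.fold (fun l s K' k' => ∃ P' U' l' T' D', l = l'.map (chainOf p enc) ∧
    s = (P'.map (chainOf p enc), U'.map (chainOf p enc), T', D') ∧
      Invariant enc p n w m B K' (a + 1) P' U' l' T' D' (k + k')) ⟨P, [], U, T, D, rfl, rfl, h⟩ ?_ ?_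
  · rintro c l _ K' k' hK ⟨P', U', l', T', D', hl, rfl, hI⟩
    rcases l' with _ | ⟨u, l'⟩
    · simp at hl
    obtain ⟨rfl, rfl⟩ := by simpa using hl
    refine (runs_levelStep hG hw hm (hK h1) (Nat.succ_pos a) hI).mono ?_
    rintro _ K'' k'' hK' ⟨P₁, U₁, T₁, D₁, rfl, hI'⟩
    exact ⟨P₁, U₁, l', T₁, D₁, rfl, rfl, by rwa [← add_assoc]⟩
  · rintro _ K' k' hK ⟨P', U', l', T', D', hl, rfl, hI⟩
    obtain rfl : l' = [] := by simpa using hl.symm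
    exact ⟨P', U', T', D', rfl, hI.next⟩

/-- A bound on the number of multiplications of the algorithm. -/
noncomputable def totalCost (p : ℕ) (G : Type*) [CommGroup G] [Finite G] (n w m : ℕ) : ℝ :=
  n * (m * w) + (∑ j ∈ Finset.range m, ((n : ℝ) - powRank p G j) *
      reduceCost p n w m (powRank p G j) +
    ∑ v ∈ Finset.range (powRank p G 0), addCost p n w v)

theorem runs_basis (hw : 2 * Nat.size (2 * p) ≤ w) (hm : ∀ g : G, height p g ≤ m)
    (h1 : (1 : G) ∈ K) {S : List G} (hS : ∀ g ∈ S, g ∈ K)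
    (hgen : Subgroup.closure {g | g ∈ S} = ⊤) :
    Runs enc K (basis p (enc 1) (S.map enc)) fun out K' k => ∃ P : List G, out = P.map enc ∧
      (∀ g ∈ P, g ∈ K') ∧ IsGroupBasis P ∧ (k : ℝ) ≤ totalCost p G S.length w m := by
  refine Runs.bind (Runs.collect (fun l acc K' k => ∃ Sd Sr, S = Sd ++ Sr ∧ l = Sr.map enc ∧
    acc = Sd.map (chainOf p enc) ∧ (∀ g ∈ Sd, ∀ i, g ^ p ^ i ∈ K') ∧ k ≤ Sd.length * (m * w))
    ⟨[], S, rfl, rfl, rfl, by simp, by simp⟩ ?_ ?_)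
  · rintro c l acc K' k hK ⟨Sd, Sr, hSS, hl, rfl, hmem, hk⟩
    rcases Sr with _ | ⟨g, Sr⟩
    · simp at hl
    obtain ⟨rfl, rfl⟩ := by simpa using hl
    refine Runs.bind ((runs_chain hG (hK (hS g (by simp [hSS]))) (hK h1)
      (le_trans (Nat.mul_le_mul_left 2
        (Nat.size_le_size (Nat.le_mul_of_pos_left _ two_pos))) hw)).mono ?_)
    rintro _ K₁ k₁ hK₁ ⟨rfl, hmem', hk₁⟩ -
    refine Runs.ret ⟨Sd ++ [g], Sr, by simp [hSS], rfl, by simp, ?_, ?_⟩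
    · intro x hx i
      rcases List.mem_append.1 hx with hx | hx
      · exact hK₁ (hmem x hx i)
      · rw [List.mem_singleton.1 hx]
        exact hmem' i
    · have : height p g * w ≤ m * w := Nat.mul_le_mul_right _ (hm g)
      rw [List.length_append, List.length_singleton, Nat.add_one_mul]
      omega
  · rintro _ K₁ k₁ hK₁ ⟨Sd, Sr, hSS, hl, rfl, hmem, hk₁⟩ -
    obtain rfl : Sr = [] := by simpa using hl.symm
    rw [List.append_nil] at hSS
    subst hSS
    rw [List.length_map]
    -- The total length of the chains bounds all heights and is available without group operations;
    -- levels above the largest height cost nothing.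
    set M := (S.map (chainOf p enc)).flatten.length with hM
    have hheight : ∀ g ∈ S, height p g ≤ M := by
      intro g hg
      rw [hM, List.length_flatten, List.map_map]
      refine (List.single_le_sum (fun _ _ => Nat.zero_le _) (height p g) ?_)
      exact List.mem_map.2 ⟨g, hg, by simp⟩
    refine Runs.bind (Runs.fold (fun l s K' k => ∃ a P U T D, a ≤ M ∧ l = List.range' (M - a) a ∧
      s = (P.map (chainOf p enc), U.map (chainOf p enc), T, D) ∧
      Invariant enc p S.length w m (totalCost p G S.length w m) K' a P [] U T D (k₁ + k))
      ⟨M, [], S, _, _, le_rfl, by simp [List.range_eq_range'], rfl, ?_⟩ ?_ ?_)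
    · refine ⟨by simpa using hmem, by simpa using hgen, by simp, Indep.nil, by simp, by simp,
        by simp, hheight, areTables_nil (hK₁ h1) (by simp [babySize]), ?_⟩
      rw [totalCost, potential, List.length_nil, ← Finset.range_eq_Ico]
      have e1 : ((k₁ + 0 : ℕ) : ℝ) ≤ S.length * (m * w) := by exact_mod_cast hk₁
      refine add_le_add e1 (add_le_add (Finset.sum_le_sum fun j _ => ?_) le_rfl)
      refine mul_le_mul_of_nonneg_right ?_ (reduceCost_nonneg _ _ _ _ _)
      have : (heightCount p [] [] S j : ℝ) ≤ S.length := by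
        exact_mod_cast (heightCount_le_length [] [] S j).trans (by simp)
      linarith
    · rintro i l _ K' k hK ⟨a, P, U, T, D, haM, hl, rfl, hI⟩
      rcases a with _ | a
      · simp at hl
      rw [List.range'_succ, List.cons.injEq] at hl
      obtain ⟨rfl, rfl⟩ := hl
      rw [Nat.sub_sub_self haM]
      refine (runs_level hG hw hm (hK (hK₁ h1)) hI).mono ?_
      rintro _ K'' k' hK' ⟨P', U', T', D', rfl, hI'⟩
      exact ⟨a, P', U', T', D', by omega, by rw [show M - (a + 1) + 1 = M - a by omega], rfl,
        by rwa [← add_assoc]⟩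
    · rintro _ K' k hK ⟨a, P, U, T, D, haM, hl, rfl, hI⟩ -
      obtain rfl : a = 0 := by simpa using (congrArg List.length hl).symm
      have hknown := hI.known
      refine Runs.ret ⟨P, ?_, ?_, isGroupBasis_of_indep hG hI.indep ?_, ?_⟩
      · rw [List.map_map]
        refine List.map_congr_left fun g hg => ?_
        obtain ⟨b, hb⟩ := Nat.exists_eq_succ_of_ne_zero (hI.height_pos g hg).ne'
        rw [Function.comp, chainOf, hb, List.range_succ_eq_map]
        simp
      · intro g hg
        simpa using hknown g (by simp [hg]) 0
      · rw [eq_top_iff, ← hI.closure, Subgroup.closure_le]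
        intro g hg
        simp only [List.append_nil, List.mem_append, Set.mem_ofPred_eq] at hg
        rcases hg with hg | hg
        · exact Subgroup.subset_closure hg
        · have h0 := (height_eq_zero_iff hG g).1 (Nat.le_zero.1 (hI.height_right g hg))
          rw [h0]
          exact Subgroup.one_mem _
      · have h2 := hI.cost
        -- The height counts never fall below the ranks, because the current elements generate `G`;
        -- hence the unspent potential can be discarded.
        have h3 : 0 ≤ potential p S.length w m P [] U := by
          refine add_nonneg (Finset.sum_nonneg fun j _ => mul_nonneg ?_ (reduceCost_nonneg _ _ _ _ _))
            (Finset.sum_nonneg fun v _ => addCost_nonneg _ _ _ _)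
          rw [sub_nonneg]
          exact_mod_cast powRank_le_countP hG hI.closure j
        simp only [add_zero]
        linarith

end Loop

/-! ### Real estimates -/

section Estimates

/-- Let `q` be the factor of `X ^ 2`. For `r < N` it is bounded by a constant, and for `q ≤ X ^ ε`
there is nothing to do. Otherwise `X < q ^ (1 / ε)`, so the left side is at most `q ^ (1 + 2 / ε)`,
which is bounded by a polynomial in `r` and is at most `√2 ^ r` for `r ≥ N`. -/
theorem exists_poly_mul_sq_le (A t : ℕ) {ε : ℝ} (hε : 0 < ε) :
    ∃ C : ℝ, 0 < C ∧ ∀ (r : ℕ) (X : ℝ), 1 ≤ X →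
      A * ((r : ℝ) + t) ^ 2 * X ^ 2 ≤ C * X ^ (2 + ε) + √2 ^ r := by
  obtain ⟨k, hk⟩ := exists_nat_ge (1 + 2 / ε)
  have h2 : (1 : ℝ) < √2 := Real.lt_sqrt_of_sq_lt (by norm_num)
  have hδ : (0 : ℝ) < 1 / ((A + 1) ^ k * √2 ^ t) := by positivity
  -- The threshold is applied to `r + t`; the factors `(A + 1) ^ k` and `√2 ^ t` compensate for `A`
  -- and for the shift by `t`.
  obtain ⟨N, hN⟩ := Filter.eventually_atTop.1
    ((tendsto_pow_const_div_const_pow_of_one_lt (2 * k) h2).eventually (ge_mem_nhds hδ))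
  refine ⟨max 1 (A * ((N : ℝ) + t) ^ 2), by positivity, fun r X hX => ?_⟩
  have hX0 : 0 < X := zero_lt_one.trans_le hX
  have hXε : 1 ≤ X ^ ε := Real.one_le_rpow hX hε.le
  have hsplit : X ^ (2 + ε) = X ^ 2 * X ^ ε := by
    rw [Real.rpow_add hX0, Real.rpow_ofNat]
  set q : ℝ := A * ((r : ℝ) + t) ^ 2 with hq
  set C : ℝ := max 1 (A * ((N : ℝ) + t) ^ 2) with hC
  have hpos : 0 ≤ √2 ^ r := by positivity
  have hq0 : 0 ≤ q := by positivity
  suffices H : q ≤ C * X ^ ε ∨ q * X ^ 2 ≤ √2 ^ r by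
    rcases H with H | H
    · rw [hsplit]
      nlinarith [mul_le_mul_of_nonneg_right H (sq_nonneg X)]
    · have : 0 ≤ C * X ^ (2 + ε) := by positivity
      linarith
  rcases lt_or_ge r N with hr | hr
  · left
    have hrN : (r : ℝ) ≤ N := by exact_mod_cast hr.le
    have h3 : q ≤ C := le_trans (by rw [hq]; gcongr) (le_max_right _ _)
    nlinarith [le_max_left 1 ((A : ℝ) * ((N : ℝ) + t) ^ 2)]
  · rcases le_or_gt q (X ^ ε) with h | h
    · left
      have : 1 ≤ C := le_max_left _ _
      nlinarith
    · right
      have hq1 : 1 ≤ q := hXε.trans h.le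
      have hXq : X ≤ q ^ (1 / ε) := by
        have := Real.rpow_le_rpow (by positivity) h.le (by positivity : 0 ≤ 1 / ε)
        rwa [← Real.rpow_mul hX0.le, mul_one_div_cancel hε.ne', Real.rpow_one] at this
      have h4 : q * X ^ 2 ≤ q ^ (1 + 2 / ε) := by
        rw [Real.rpow_add (by linarith), Real.rpow_one]
        refine mul_le_mul_of_nonneg_left ?_ hq0
        calc X ^ 2 ≤ (q ^ (1 / ε)) ^ 2 := by gcongr
          _ = q ^ (2 / ε) := by
            rw [← Real.rpow_natCast, ← Real.rpow_mul hq0]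
            congr 1
            push_cast
            ring
      have h5 : q ^ (1 + 2 / ε) ≤ q ^ k := by
        rw [← Real.rpow_natCast]
        exact Real.rpow_le_rpow_of_exponent_le hq1 hk
      have h6 := hN (r + t) (by omega)
      rw [div_le_iff₀ (by positivity), one_div, pow_add, inv_mul_eq_div, le_div_iff₀ (by positivity)]
        at h6
      have h7 : q ^ k ≤ √2 ^ r := by
        refine le_of_mul_le_mul_right ?_ (by positivity : 0 < √2 ^ t)
        refine le_trans ?_ h6
        rw [hq, mul_pow, ← pow_mul]
        push_cast
        have hA : (A : ℝ) ^ k ≤ (A + 1) ^ k := by gcongr; linarith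
        have := mul_le_mul_of_nonneg_right hA
          (by positivity : 0 ≤ ((r : ℝ) + t) ^ (2 * k) * √2 ^ t)
        linarith
      exact h4.trans (h5.trans h7)

theorem exists_logb_rpow_le {s : ℝ} (hs : 0 < s) :
    ∃ C : ℝ, 0 < C ∧ ∀ y : ℝ, 1 ≤ y → Real.logb 2 y ^ s ≤ C * y ^ (1 / 2 : ℝ) := by
  have hl : 0 < Real.log 2 := Real.log_pos one_lt_two
  have hδ : 0 < 1 / (2 * s) := by positivity
  refine ⟨(1 / (1 / (2 * s) * Real.log 2)) ^ s, by positivity, fun y hy => ?_⟩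
  have hy0 : 0 ≤ y := zero_le_one.trans hy
  have h1 : Real.logb 2 y ≤ 1 / (1 / (2 * s) * Real.log 2) * y ^ (1 / (2 * s)) := by
    rw [Real.logb, div_le_iff₀ hl]
    refine (Real.log_le_rpow_div hy0 hδ).trans (le_of_eq ?_)
    field_simp
  refine (Real.rpow_le_rpow (Real.logb_nonneg one_lt_two hy) h1 hs.le).trans (le_of_eq ?_)
  rw [Real.mul_rpow (by positivity) (by positivity), ← Real.rpow_mul hy0]
  congr 2
  field_simp

variable {p : ℕ}

theorem sqrt_two_le_sqrtPow_one (hp : 2 ≤ p) : √2 ≤ sqrtPow p 1 := by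
  refine Real.sqrt_le_iff.2 ⟨sqrtPow_nonneg _ _, ?_⟩
  rw [sqrtPow_sq, pow_one]
  exact_mod_cast hp

theorem sqrtPow_add (hp : 0 < p) (a b : ℕ) : sqrtPow p (a + b) = sqrtPow p a * sqrtPow p b := by
  rw [sqrtPow, sqrtPow, sqrtPow, ← Real.rpow_add (by exact_mod_cast hp)]
  push_cast
  congr 1
  ring

theorem sqrtPow_zero : sqrtPow p 0 = 1 := by simp [sqrtPow]

theorem sqrt_two_pow_le_sqrtPow (hp : 2 ≤ p) (r : ℕ) : √2 ^ r ≤ sqrtPow p r := by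
  induction r with
  | zero => simp [sqrtPow_zero]
  | succ r ih =>
    rw [pow_succ, sqrtPow_add (by omega)]
    exact mul_le_mul ih (sqrt_two_le_sqrtPow_one hp) (by positivity) (sqrtPow_nonneg _ _)

theorem seven_fifths_le_sqrtPow_one (hp : 2 ≤ p) : (7 / 5 : ℝ) ≤ sqrtPow p 1 :=
  (Real.le_sqrt_of_sq_le (by norm_num)).trans (sqrt_two_le_sqrtPow_one hp)

theorem one_le_sqrtPow (hp : 2 ≤ p) (r : ℕ) : 1 ≤ sqrtPow p r := by
  rw [← sqrtPow_zero (p := p)]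
  exact sqrtPow_mono (by omega) (Nat.zero_le r)

/-- A geometric sum with linear weights. Raising `r` by one replaces `A` by `A + 2` in the old
terms, so the step needs `4 * A + 35 ≤ 7 / 5 * (3 * A + 25)`, where `7 / 5 < √2` bounds the ratio
from below. -/
theorem sum_linear_mul_sqrtPow_le (hp : 2 ≤ p) (r : ℕ) {A : ℝ} (hA : 0 ≤ A) :
    ∑ v ∈ Finset.range r, (A + 2 * ((r : ℝ) - v)) * sqrtPow p (v + 1) ≤
      (4 * A + 27) * sqrtPow p r := by
  induction r generalizing A with
  | zero =>
    have := sqrtPow_nonneg p 0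
    simp only [Finset.range_zero, Finset.sum_empty]
    positivity
  | succ r ih =>
    rw [Finset.sum_range_succ]
    have h1 := ih (A := A + 2) (by linarith)
    have h2 : ∑ v ∈ Finset.range r, (A + 2 * (((r + 1 : ℕ) : ℝ) - v)) * sqrtPow p (v + 1) =
        ∑ v ∈ Finset.range r, (A + 2 + 2 * ((r : ℝ) - v)) * sqrtPow p (v + 1) := by
      refine Finset.sum_congr rfl fun v _ => ?_
      push_cast
      ring
    rw [h2]
    have h3 := seven_fifths_le_sqrtPow_one hp
    have h4 : 0 < sqrtPow p r := sqrtPow_pos (by omega) r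
    have h5 : 7 / 5 * sqrtPow p r ≤ sqrtPow p (r + 1) := by
      rw [sqrtPow_add (by omega)]
      nlinarith
    push_cast
    have h6 : 0 ≤ 3 * A + 25 := by linarith
    have h7 := mul_le_mul_of_nonneg_left h5 h6
    nlinarith [mul_nonneg hA h4.le]

/-- A sum is dominated by the product, since every factor is at least `7 / 5`. With `s ≥ 1` and `x ≥
7 / 5`, the step is `7 / 2 * s + x ≤ 7 / 2 * s * x`, an equality at `s = 1`, `x = 7 / 5`. -/
theorem sum_sqrtPow_le (hp : 2 ≤ p) (r : ℕ → ℕ) (m : ℕ) (hr : ∀ j < m, 0 < r j) :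
    ∑ j ∈ Finset.range m, sqrtPow p (r j) ≤
      7 / 2 * sqrtPow p (∑ j ∈ Finset.range m, r j) := by
  induction m with
  | zero => simpa using sqrtPow_nonneg p 0
  | succ m ih =>
    rw [Finset.sum_range_succ, Finset.sum_range_succ, sqrtPow_add (by omega)]
    have h1 := ih fun j hj => hr j (by omega)
    have h2 : 7 / 5 ≤ sqrtPow p (r m) :=
      (seven_fifths_le_sqrtPow_one hp).trans (sqrtPow_mono (by omega) (hr m (by omega)))
    have h3 := one_le_sqrtPow hp (∑ j ∈ Finset.range m, r j)
    nlinarith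

theorem logb_logb_three_pos : 0 < Real.logb 2 (Real.logb 2 3) := by
  refine Real.logb_pos one_lt_two ?_
  rw [Real.lt_logb_iff_rpow_lt one_lt_two (by norm_num)]
  norm_num

theorem size_le_logb (hp : 2 ≤ p) : ((2 * Nat.size (2 * p) : ℕ) : ℝ) ≤ 6 * Real.logb 2 p := by
  have hp0 : (0 : ℝ) < p := by exact_mod_cast (by omega : 0 < p)
  obtain ⟨s, hs⟩ : ∃ s, Nat.size (2 * p) = s + 1 :=
    Nat.exists_eq_succ_of_ne_zero (by rw [Ne, Nat.size_eq_zero]; omega)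
  have h1 : 2 ^ s ≤ 2 * p := Nat.lt_size.1 (by omega)
  have h2 : (s : ℝ) ≤ Real.logb 2 (2 * p) := by
    rw [Real.le_logb_iff_rpow_le one_lt_two (by positivity), Real.rpow_natCast]
    exact_mod_cast h1
  rw [Real.logb_mul two_ne_zero hp0.ne', Real.logb_self_eq_one one_lt_two] at h2
  have h3 : 1 ≤ Real.logb 2 p := by
    rw [Real.le_logb_iff_rpow_le one_lt_two hp0, Real.rpow_one]
    exact_mod_cast hp
  rw [hs]
  push_cast
  linarith

end Estimates

/-! ### The bounds in terms of the group order and `T_DL` -/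

section Basis

variable {G : Type*} [CommGroup G] [Finite G] {p : ℕ}

omit [Finite G] in
theorem closure_eq_top_of_isGroupBasis {α : List G} (h : IsGroupBasis α) :
    Subgroup.closure {g | g ∈ α} = ⊤ := by
  rw [eq_top_iff]
  intro β _
  obtain ⟨x, ⟨-, hx⟩, -⟩ := h β
  rw [← hx]
  exact Subgroup.prod_mem _ fun i _ =>
    Subgroup.pow_mem _ (Subgroup.subset_closure (show α.get i ∈ {g | g ∈ α} from List.get_mem α i)) _

-- A basis is a bijection from the box of admissible exponents to the group.
omit [Finite G] in
theorem prod_orderOf_of_isGroupBasis {α : List G} (h : IsGroupBasis α) :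
    (α.map orderOf).prod = Nat.card G := by
  let F : (∀ i : Fin α.length, Fin (orderOf (α.get i))) → G := fun x => ∏ i, α.get i ^ (x i : ℕ)
  have hF : Function.Bijective F := by
    refine ⟨fun x y hxy => ?_, fun β => ?_⟩
    · obtain ⟨z, -, hz⟩ := h (F x)
      have h1 := hz (fun i => x i) ⟨fun i => (x i).2, rfl⟩
      have h2 := hz (fun i => y i) ⟨fun i => (y i).2, hxy.symm⟩
      funext i
      exact Fin.ext (congrFun (h1.trans h2.symm) i)
    · obtain ⟨x, ⟨hx, hx'⟩, -⟩ := h β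
      exact ⟨fun i => ⟨x i, hx i⟩, hx'⟩
  rw [← Nat.card_eq_of_bijective F hF, Nat.card_pi]
  simp only [Nat.card_fin]
  rw [← List.prod_ofFn]
  congr 1
  conv_lhs => rw [← List.ofFn_get α, List.map_ofFn]
  rfl

theorem powRank_zero : powRank p G 0 = Group.rank G := by
  have : (powMonoidHom (p ^ 0) : G →* G).range = ⊤ := by
    rw [eq_top_iff]
    exact fun g _ => ⟨g, by simp⟩
  rw [powRank, Subgroup.rank_congr this]
  exact Group.rank_congr Subgroup.topEquiv

theorem pow_log_exponent_le : p ^ Nat.log p (Monoid.exponent G) ≤ Nat.card G :=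
  (Nat.pow_log_le_self p Monoid.exponent_ne_zero_of_finite).trans
    (Nat.le_of_dvd Nat.card_pos Group.exponent_dvd_nat_card)

omit [Finite G] in
theorem sum_countP_height_le (L : List G) (m : ℕ) :
    ∑ j ∈ Finset.range m, L.countP (fun g => j < height p g) ≤ (L.map (height p)).sum := by
  induction L with
  | nil => simp
  | cons g L ih =>
    simp only [List.countP_cons, Finset.sum_add_distrib, List.map_cons, List.sum_cons,
      decide_eq_true_eq]
    rw [add_comm]
    refine add_le_add ?_ ih
    rw [← Finset.sum_filter, Finset.sum_const, smul_eq_mul, mul_one]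
    refine (Finset.card_le_card (t := Finset.range (height p g)) fun j hj => ?_).trans
      (Finset.card_range _).le
    simpa using (Finset.mem_filter.1 hj).2

/-- The part of the discrete logarithm cost that depends on the individual orders. -/
noncomputable def orderCost (p : ℕ) (a : G) : ℝ :=
  Real.logb 2 ((Nat.log p (orderOf a) : ℝ) + 1) /
    Real.logb 2 (Real.logb 2 ((Nat.log p (orderOf a) : ℝ) + 2)) * Real.logb 2 (orderOf a : ℝ)

theorem dlCost_eq (α : List G) : dlCost p α = (α.map (orderCost p)).sum +
    ∑ j ∈ Finset.range (Nat.log p (Monoid.exponent G)), sqrtPow p (powRank p G j) := rfl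

theorem logb_orderOf_nonneg (a : G) : 0 ≤ Real.logb 2 (orderOf a : ℝ) :=
  Real.logb_nonneg one_lt_two (by exact_mod_cast orderOf_pos a)

theorem orderCost_nonneg (a : G) : 0 ≤ orderCost p a := by
  have h1 : (0 : ℝ) ≤ Nat.log p (orderOf a) := Nat.cast_nonneg _
  refine mul_nonneg (div_nonneg (Real.logb_nonneg one_lt_two (by linarith))
    (Real.logb_nonneg one_lt_two ?_)) (logb_orderOf_nonneg a)
  rw [Real.le_logb_iff_rpow_le one_lt_two (by linarith), Real.rpow_one]
  linarith

variable [hp : Fact p.Prime]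

/-- If the `p ^ j`-th powers were trivial, the exponent would divide `p ^ j`. -/
theorem powRank_pos {j : ℕ} (hj : j < Nat.log p (Monoid.exponent G)) : 0 < powRank p G j := by
  rw [powRank, pos_iff_ne_zero, Ne, Group.rank_eq_zero_iff]
  intro hs
  have h1 : Monoid.exponent G ∣ p ^ j := Monoid.exponent_dvd_of_forall_pow_eq_one fun g =>
    congrArg Subtype.val (Subsingleton.elim
      (⟨g ^ p ^ j, g, rfl⟩ : (powMonoidHom (p ^ j) : G →* G).range) 1)
  have h2 := Nat.log_mono_right (b := p) (Nat.le_of_dvd (pow_pos hp.out.pos j) h1)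
  rw [Nat.log_pow hp.out.one_lt] at h2
  omega

variable (hG : IsPGroup p G)
include hG

/-- The rank `r_j` is at most the number of basis elements of height greater than `j`; summed over
`j`, these numbers give at most the sum of the heights, which is `log_p |G|`. -/
theorem pow_sum_powRank_le {α : List G} (h : IsGroupBasis α) (m : ℕ) :
    p ^ ∑ j ∈ Finset.range m, powRank p G j ≤ Nat.card G := by
  have h1 : ∑ j ∈ Finset.range m, powRank p G j ≤ (α.map (height p)).sum :=
    (Finset.sum_le_sum fun j _ => powRank_le_countP hG (closure_eq_top_of_isGroupBasis h) j).trans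
      (sum_countP_height_le α m)
  refine (Nat.pow_le_pow_right hp.out.pos h1).trans (le_of_eq ?_)
  rw [← prod_orderOf_of_isGroupBasis h]
  clear h h1
  induction α with
  | nil => simp
  | cons g α ih =>
    simp only [List.map_cons, List.sum_cons, List.prod_cons, pow_add, ih,
      orderOf_eq_pow_height hG]

theorem sum_sqrtPow_powRank_le {α : List G} (h : IsGroupBasis α) :
    ∑ j ∈ Finset.range (Nat.log p (Monoid.exponent G)), sqrtPow p (powRank p G j) ≤
      7 / 2 * (Nat.card G : ℝ) ^ (1 / 2 : ℝ) := by
  refine (sum_sqrtPow_le hp.out.two_le _ _ fun j hj => powRank_pos hj).trans ?_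
  have h1 : sqrtPow p (∑ j ∈ Finset.range (Nat.log p (Monoid.exponent G)), powRank p G j) ≤
      (Nat.card G : ℝ) ^ (1 / 2 : ℝ) := by
    rw [← Real.sqrt_eq_rpow]
    refine Real.le_sqrt_of_sq_le ?_
    rw [sqrtPow_sq]
    exact_mod_cast pow_sum_powRank_le hG h _
  linarith

theorem orderCost_le (a : G) : orderCost p a ≤
    Real.logb 2 (Nat.card G) / Real.logb 2 (Real.logb 2 3) * Real.logb 2 (orderOf a) := by
  have hκ := logb_logb_three_pos
  have hpR : (2 : ℝ) ≤ p := by exact_mod_cast hp.out.two_le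
  have hord : orderOf a = p ^ height p a := orderOf_eq_pow_height hG a
  have hcard : Real.logb 2 (orderOf a) ≤ Real.logb 2 (Nat.card G) :=
    Real.logb_le_logb_of_le one_lt_two (by exact_mod_cast orderOf_pos a)
      (by exact_mod_cast Nat.le_of_dvd Nat.card_pos (orderOf_dvd_natCard a))
  rcases Nat.eq_zero_or_pos (height p a) with h0 | h0
  -- For a trivial element the factor `lg |a|` vanishes, so including it in `dlCost` is harmless.
  · rw [orderCost, hord, h0]
    simp
  refine mul_le_mul_of_nonneg_right ?_ (logb_orderOf_nonneg a)
  change Real.logb 2 ((height p a : ℝ) + 1) /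
    Real.logb 2 (Real.logb 2 ((height p a : ℝ) + 2)) ≤ _
  have h1 : (1 : ℝ) ≤ height p a := by exact_mod_cast h0
  have h2 : Real.logb 2 ((height p a : ℝ) + 1) ≤ height p a := by
    rw [Real.logb_le_iff_le_rpow one_lt_two (by linarith), Real.rpow_natCast]
    exact_mod_cast Nat.lt_two_pow_self
  have h3 : (height p a : ℝ) ≤ Real.logb 2 (orderOf a) := by
    rw [Real.le_logb_iff_rpow_le one_lt_two (by exact_mod_cast orderOf_pos a), Real.rpow_natCast,
      hord]
    push_cast
    gcongr
  refine div_le_div₀ ((logb_orderOf_nonneg a).trans hcard) (h2.trans (h3.trans hcard)) hκ ?_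
  have h4 : 1 < Real.logb 2 3 := by
    rw [Real.lt_logb_iff_rpow_lt one_lt_two (by norm_num)]
    norm_num
  exact Real.logb_le_logb_of_le one_lt_two (by linarith)
    (Real.logb_le_logb_of_le one_lt_two (by norm_num) (by linarith))

theorem sum_orderCost_le {α : List G} (h : IsGroupBasis α) : (α.map (orderCost p)).sum ≤
    Real.logb 2 (Nat.card G) ^ 2 / Real.logb 2 (Real.logb 2 3) := by
  have h1 : (α.map fun a => Real.logb 2 (orderOf a : ℝ)).sum = Real.logb 2 (Nat.card G) := by
    rw [← prod_orderOf_of_isGroupBasis h]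
    clear h
    induction α with
    | nil => simp
    | cons a α ih =>
      have hne : ((α.map orderOf).prod : ℝ) ≠ 0 := by
        rw [Nat.cast_ne_zero]
        refine List.prod_ne_zero ?_
        simp only [List.mem_map, not_exists, not_and]
        exact fun x _ => (orderOf_pos x).ne'
      rw [List.map_cons, List.sum_cons, ih, List.map_cons, List.prod_cons, Nat.cast_mul,
        Real.logb_mul (by exact_mod_cast (orderOf_pos a).ne') hne]
  calc (α.map (orderCost p)).sum
      ≤ (α.map fun a => Real.logb 2 (Nat.card G) / Real.logb 2 (Real.logb 2 3) *
          Real.logb 2 (orderOf a)).sum := List.sum_le_sum fun a _ => orderCost_le hG a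
    _ = _ := by
      rw [List.sum_map_mul_left, h1]
      ring

/-- The sum over `j` is the searches in the reductions, and the last term is the additions: searches
and tables give the weights `6 + 2 * t + 2 * (r - v)`, whence `4 * (6 + 2 * t) + 27 = 51 + 8 * t`.
Everything else is at most a multiple of `n ^ 2 * lg ^ 2 |G|`. -/
theorem totalCost_le [Nontrivial G] {n t : ℕ} (hn : n ≤ Group.rank G + t) (hr : Group.rank G ≤ n)
    (hrn : ∀ j, powRank p G j ≤ n) :
    totalCost p G n (2 * Nat.size (2 * p)) (Nat.log p (Monoid.exponent G)) ≤
      54 * ((Group.rank G : ℝ) + t) ^ 2 * Real.logb 2 (Nat.card G) ^ 2 +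
        3 * ∑ j ∈ Finset.range (Nat.log p (Monoid.exponent G)), sqrtPow p (powRank p G j) +
        (51 + 8 * t) * sqrtPow p (Group.rank G) := by
  set m := Nat.log p (Monoid.exponent G) with hm
  set w := 2 * Nat.size (2 * p) with hw
  set X := Real.logb 2 (Nat.card G) with hX
  set r := Group.rank G with hrdef
  have hr0 : 1 ≤ r := Group.rank_pos G
  have hp2 := hp.out.two_le
  have hlp : 1 ≤ Real.logb 2 p := by
    rw [Real.le_logb_iff_rpow_le one_lt_two (by exact_mod_cast hp.out.pos), Real.rpow_one]
    exact_mod_cast hp2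
  have hmX : m * Real.logb 2 p ≤ X := by
    rw [← Real.logb_pow]
    refine Real.logb_le_logb_of_le one_lt_two (by exact_mod_cast pow_pos hp.out.pos m) ?_
    exact_mod_cast pow_log_exponent_le
  have hm1 : (1 : ℝ) ≤ m := by
    have : 0 < m := by
      obtain ⟨g, hg⟩ := exists_ne (1 : G)
      have h1 := height_le_log_exponent (p := p) g
      have h2 := (height_eq_zero_iff hG g).not.2 hg
      omega
    exact_mod_cast this
  have hwp : (w : ℝ) ≤ 6 * Real.logb 2 p := size_le_logb hp2
  have hw0 : (0 : ℝ) ≤ w := Nat.cast_nonneg w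
  have hmX' : (m : ℝ) ≤ X := by nlinarith
  have hX1 : 1 ≤ X := hm1.trans hmX'
  have hmw : (m : ℝ) * w ≤ 6 * X := by nlinarith
  have hwX : (w : ℝ) ≤ 6 * X := by nlinarith
  have hn1 : (1 : ℝ) ≤ n := by exact_mod_cast hr0.trans hr
  have hnt : (n : ℝ) ≤ r + t := by exact_mod_cast hn
  have hrn' : (r : ℝ) ≤ n := by exact_mod_cast hr
  -- the reductions
  have hred : ∑ j ∈ Finset.range m, ((n : ℝ) - powRank p G j) *
        reduceCost p n w m (powRank p G j) ≤
      3 * ∑ j ∈ Finset.range m, sqrtPow p (powRank p G j) +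
        m * (n * (1 + n * (w + 1) + m * w)) := by
    have : ∀ j ∈ Finset.range m, ((n : ℝ) - powRank p G j) *
        reduceCost p n w m (powRank p G j) ≤
          3 * sqrtPow p (powRank p G j) + n * (1 + n * (w + 1) + m * w) := by
      intro j _
      have hc : ((n + 1 - powRank p G j : ℕ) : ℝ) = n + 1 - powRank p G j := by
        rw [Nat.cast_sub ((hrn j).trans (Nat.le_succ n))]
        push_cast
        rfl
      have hd : (powRank p G j : ℝ) ≤ n := by exact_mod_cast hrn j
      have hd0 : (0 : ℝ) ≤ powRank p G j := Nat.cast_nonneg _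
      have hs := sqrtPow_nonneg p (powRank p G j)
      -- Here the factor `n + 1 - v` in the number of baby steps pays off: the possible `n - r_j`
      -- reductions together cost no more than `3 * p ^ (r_j / 2)` in searches.
      have e1 : ((n : ℝ) - powRank p G j) *
          (3 * sqrtPow p (powRank p G j) / (n + 1 - powRank p G j : ℕ)) ≤
            3 * sqrtPow p (powRank p G j) := by
        rw [hc, mul_div_assoc', div_le_iff₀ (by linarith)]
        nlinarith
      have e2 : ((n : ℝ) - powRank p G j) * (1 + n * (w + 1) + m * w) ≤
          n * (1 + n * (w + 1) + m * w) :=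
        mul_le_mul_of_nonneg_right (by linarith) (by positivity)
      rw [reduceCost]
      linarith
    refine (Finset.sum_le_sum this).trans (le_of_eq ?_)
    rw [Finset.sum_add_distrib, ← Finset.mul_sum, Finset.sum_const, Finset.card_range,
      nsmul_eq_mul]
  -- the additions
  have hadd : ∑ v ∈ Finset.range r, addCost p n w v ≤
      (51 + 8 * t) * sqrtPow p r + r * (2 + n * (2 * w)) := by
    have : ∀ v ∈ Finset.range r, addCost p n w v ≤
        ((6 + 2 * t) + 2 * ((r : ℝ) - v)) * sqrtPow p (v + 1) + (2 + n * (2 * w)) := by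
      intro v hv
      rw [Finset.mem_range] at hv
      have hvn : v + 1 ≤ n := by omega
      have e1 := sqrtPow_mono hp.out.pos (Nat.le_succ v)
      have e2 : (babySize p n (v + 1) : ℝ) ≤ ((r : ℝ) + t - v) * (2 * sqrtPow p (v + 1)) := by
        rw [babySize, Nat.add_sub_add_right, Nat.cast_mul, Nat.cast_sub (by omega)]
        push_cast
        refine mul_le_mul (by linarith) ?_ (by positivity) ?_
        · have := nat_sqrt_le_sqrtPow p (v + 1)
          have := one_le_sqrtPow hp2 (v + 1)
          linarith
        · have : (v : ℝ) ≤ n := by exact_mod_cast (by omega : v ≤ n)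
          linarith
      have e3 : ((v : ℝ) + 1) * (2 * w) ≤ n * (2 * w) :=
        mul_le_mul_of_nonneg_right (by exact_mod_cast hvn) (by positivity)
      rw [addCost]
      rw [Nat.succ_eq_add_one] at e1
      linarith
    refine (Finset.sum_le_sum this).trans ?_
    rw [Finset.sum_add_distrib, Finset.sum_const, Finset.card_range, nsmul_eq_mul]
    have := sum_linear_mul_sqrtPow_le hp2 r (A := 6 + 2 * t) (by positivity)
    linarith
  have hnn : (n : ℝ) ^ 2 ≤ (r + t) ^ 2 := by gcongr
  have hXX : X ≤ X ^ 2 := by nlinarith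
  have hn2 : (n : ℝ) ≤ n ^ 2 := by nlinarith
  have hnX : 0 ≤ (n : ℝ) ^ 2 * X ^ 2 := by positivity
  have hone : 1 ≤ X ^ 2 := hX1.trans hXX
  -- The six bounds below add up to `34`, so `54` leaves room.
  have hover : (n : ℝ) * (m * w) + m * (n * (1 + n * (w + 1) + m * w)) + r * (2 + n * (2 * w)) ≤
      54 * ((n : ℝ) ^ 2 * X ^ 2) := by
    have a1 : (n : ℝ) * (m * w) ≤ 6 * (n ^ 2 * X ^ 2) := by
      calc (n : ℝ) * (m * w) ≤ n ^ 2 * (6 * X ^ 2) :=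
            mul_le_mul hn2 (by linarith) (by positivity) (by positivity)
        _ = _ := by ring
    have a2 : (n : ℝ) * m ≤ n ^ 2 * X ^ 2 :=
      mul_le_mul hn2 (by linarith) (by positivity) (by positivity)
    have a3 : (n : ℝ) ^ 2 * (m * w + m) ≤ n ^ 2 * (7 * X ^ 2) :=
      mul_le_mul_of_nonneg_left (by linarith) (by positivity)
    have a4 : (n : ℝ) * (m * (m * w)) ≤ n ^ 2 * (6 * X ^ 2) := by
      refine mul_le_mul hn2 ?_ (by positivity) (by positivity)
      calc (m : ℝ) * (m * w) ≤ X * (6 * X) := mul_le_mul hmX' hmw (by positivity) (by positivity)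
        _ = 6 * X ^ 2 := by ring
    have a5 : (r : ℝ) * 2 ≤ 2 * (n ^ 2 * X ^ 2) := by nlinarith
    have a6 : (r : ℝ) * (n * (2 * w)) ≤ n ^ 2 * (12 * X ^ 2) := by
      calc (r : ℝ) * (n * (2 * w)) ≤ n * (n * (12 * X ^ 2)) := by
            refine mul_le_mul hrn' ?_ (by positivity) (by positivity)
            refine mul_le_mul_of_nonneg_left (by linarith) (by positivity)
        _ = _ := by ring
    nlinarith
  have hfin : 54 * ((n : ℝ) ^ 2 * X ^ 2) ≤ 54 * (((r : ℝ) + t) ^ 2 * X ^ 2) := by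
    gcongr
  rw [totalCost, powRank_zero]
  linarith

end Basis

/-- The algorithm computes a basis within the bound `totalCost`. -/
theorem exists_run_isGroupBasis {p : ℕ} (hp : p.Prime) {G : Type*} [CommGroup G] [Finite G]
    (hG : IsPGroup p G) {S : List G} (hS : Subgroup.closure {g : G | g ∈ S} = ⊤) (enc : G ↪ ℕ) :
    ∃ (k : ℕ) (out : List G), algorithm.Run p enc S [] k out ∧ IsGroupBasis out ∧
      (k : ℝ) ≤ totalCost p G S.length (2 * Nat.size (2 * p)) (Nat.log p (Monoid.exponent G)) := by
  have : Fact p.Prime := ⟨hp⟩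
  obtain ⟨k, out, K, ⟨P, hP, -, hbasis, hk⟩, hrun⟩ := exists_run
    (runs_basis (enc := enc) (K := {g | g ∈ GenericAlgorithm.known S []}) hG le_rfl
      height_le_log_exponent (by simp [GenericAlgorithm.known])
      (fun g hg => by simp [GenericAlgorithm.known, hg]) hS)
    fun x K k ⟨P, hx, hP, _⟩ => ⟨P, hP, hx⟩
  obtain rfl : out = P := List.map_injective_iff.2 enc.injective hP
  exact ⟨k, out, hrun, hbasis, hk⟩

theorem totalCost_of_subsingleton {p : ℕ} {G : Type*} [CommGroup G] [Finite G] [Subsingleton G]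
    (n w : ℕ) : totalCost p G n w (Nat.log p (Monoid.exponent G)) = 0 := by
  rw [totalCost, powRank_zero, Group.rank_eq_zero, Monoid.exp_eq_one_of_subsingleton, Nat.log_one_right]
  simp

theorem le_dlCost {p : ℕ} {G : Type*} [CommGroup G] [Finite G] (α : List G) :
    ∑ j ∈ Finset.range (Nat.log p (Monoid.exponent G)), sqrtPow p (powRank p G j) ≤
      dlCost p α := by
  rw [dlCost_eq]
  have : 0 ≤ (α.map (orderCost p)).sum := List.sum_nonneg fun x hx => by
    obtain ⟨a, -, rfl⟩ := List.mem_map.1 hx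
    exact orderCost_nonneg a
  linarith

/-- The number of multiplications is bounded in terms of the cost of discrete logarithms. -/
theorem exists_totalCost_le (t : ℕ) {ε : ℝ} (hε : 0 < ε) : ∃ C : ℝ, 0 < C ∧
    ∀ (p : ℕ), p.Prime → ∀ (G : Type*) [CommGroup G] [Finite G], IsPGroup p G →
      ∀ (S : List G), Subgroup.closure {g : G | g ∈ S} = ⊤ → S.length ≤ Group.rank G + t →
        ∀ α : List G,
          totalCost p G S.length (2 * Nat.size (2 * p)) (Nat.log p (Monoid.exponent G)) ≤
            C * Real.logb 2 (Nat.card G) ^ (2 + ε) + (55 + 8 * t) * dlCost p α := by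
  obtain ⟨C, hC, hbound⟩ := exists_poly_mul_sq_le 54 t hε
  refine ⟨C, hC, fun p hp G _ _ hG S hS hSt α => ?_⟩
  have : Fact p.Prime := ⟨hp⟩
  have hdl := le_dlCost (p := p) α
  have hX0 : 0 ≤ Real.logb 2 (Nat.card G) :=
    Real.logb_nonneg one_lt_two (by exact_mod_cast Nat.card_pos)
  -- The trivial group is separate because the estimates need `lg |G| ≥ 1`.
  rcases subsingleton_or_nontrivial G with hs | hnt
  · rw [totalCost_of_subsingleton]
    have h1 : 0 ≤ dlCost p α := (Finset.sum_nonneg fun j _ => sqrtPow_nonneg _ _).trans hdl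
    positivity
  · have hrank : ∀ j, powRank p G j ≤ S.length := fun j =>
      (powRank_le_countP hG hS j).trans List.countP_le_length
    have h1 := totalCost_le hG hSt (powRank_zero (p := p) (G := G) ▸ hrank 0) hrank
    have hX : 1 ≤ Real.logb 2 (Nat.card G) := by
      rw [Real.le_logb_iff_rpow_le one_lt_two (by exact_mod_cast Nat.card_pos), Real.rpow_one]
      exact_mod_cast Finite.one_lt_card
    have h2 := hbound (Group.rank G) _ hX
    have h3 := sqrt_two_pow_le_sqrtPow hp.two_le (Group.rank G)
    have h4 : sqrtPow p (Group.rank G) ≤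
        ∑ j ∈ Finset.range (Nat.log p (Monoid.exponent G)), sqrtPow p (powRank p G j) := by
      rw [← powRank_zero (p := p)]
      refine Finset.single_le_sum (f := fun j => sqrtPow p (powRank p G j))
        (fun j _ => sqrtPow_nonneg _ _) (Finset.mem_range.2 ?_)
      obtain ⟨g, hg⟩ := exists_ne (1 : G)
      have h5 := height_le_log_exponent (p := p) g
      have h6 := (height_eq_zero_iff hG g).not.2 hg
      omega
    have h5 := h4.trans hdl
    -- The `51 + 8 * t` of the additions and one more for `√2 ^ r`; the reductions contribute
    -- another `3`, for a total of `55 + 8 * t`.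
    have h6 : (52 + 8 * (t : ℝ)) * sqrtPow p (Group.rank G) ≤ (52 + 8 * t) * dlCost p α :=
      mul_le_mul_of_nonneg_left h5 (by positivity)
    push_cast at h2
    linarith

/-- The bound is of the order of the square root of the group order. -/
theorem exists_bound_le_sqrt {C c ε : ℝ} (hC : 0 < C) (hc : 0 < c) (hε : 0 < ε) :
    ∃ C' : ℝ, 0 < C' ∧ ∀ (p : ℕ), p.Prime → ∀ (G : Type*) [CommGroup G] [Finite G],
      IsPGroup p G → ∀ α : List G, IsGroupBasis α →
        C * Real.logb 2 (Nat.card G : ℝ) ^ (2 + ε) + c * dlCost p α ≤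
          C' * (Nat.card G : ℝ) ^ (1 / 2 : ℝ) := by
  obtain ⟨C₁, hC₁, h₁⟩ := exists_logb_rpow_le (s := 2 + ε) (by positivity)
  obtain ⟨C₂, hC₂, h₂⟩ := exists_logb_rpow_le (s := 2) two_pos
  have hκ := logb_logb_three_pos
  refine ⟨C * C₁ + c * (C₂ / Real.logb 2 (Real.logb 2 3) + 7 / 2), by positivity,
    fun p hp G _ _ hG α hα => ?_⟩
  have : Fact p.Prime := ⟨hp⟩
  have hy : (1 : ℝ) ≤ Nat.card G := by exact_mod_cast Nat.card_pos
  have e1 := mul_le_mul_of_nonneg_left (h₁ _ hy) hC.le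
  have e2 := h₂ _ hy
  rw [Real.rpow_ofNat] at e2
  have e3 : dlCost p α ≤ (C₂ / Real.logb 2 (Real.logb 2 3) + 7 / 2) *
      (Nat.card G : ℝ) ^ (1 / 2 : ℝ) := by
    rw [dlCost_eq, add_mul]
    refine add_le_add ((sum_orderCost_le hG hα).trans ?_) (sum_sqrtPow_powRank_le hG hα)
    rw [div_mul_eq_mul_div]
    exact div_le_div_of_nonneg_right e2 hκ.le
  have e4 := mul_le_mul_of_nonneg_left e3 hc.le
  linarith

end BasisAlgorithm

theorem corollary2 :
    ∃ A : GenericAlgorithm, ∀ t : ℕ, ∃ c : ℝ, 0 < c ∧ ∀ ε : ℝ, 0 < ε →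
      ∃ C C' : ℝ, 0 < C ∧ 0 < C' ∧
        ∀ (p : ℕ), p.Prime → ∀ (G : Type*) [CommGroup G] [Finite G], IsPGroup p G →
          ∀ (S : List G), Subgroup.closure {g : G | g ∈ S} = ⊤ →
            S.length ≤ Group.rank G + t →
            ∀ enc : G ↪ ℕ, ∃ (k : ℕ) (out : List G),
              A.Run p enc S [] k out ∧ IsGroupBasis out ∧
                ∀ α : List G, IsGroupBasis α →
                  (k : ℝ) ≤ C * Real.logb 2 (Nat.card G : ℝ) ^ (2 + ε) + c * dlCost p α ∧
                  C * Real.logb 2 (Nat.card G : ℝ) ^ (2 + ε) + c * dlCost p α ≤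
                    C' * (Nat.card G : ℝ) ^ (1 / 2 : ℝ) := by
  -- The algorithm does not depend on `t`, and `55 + 8 * t` does not depend on `ε`.
  refine ⟨BasisAlgorithm.algorithm, fun t => ⟨55 + 8 * t, by positivity, fun ε hε => ?_⟩⟩
  obtain ⟨C, hC, hk⟩ := BasisAlgorithm.exists_totalCost_le t hε
  obtain ⟨C', hC', hsqrt⟩ :=
    BasisAlgorithm.exists_bound_le_sqrt (c := 55 + 8 * t) hC (by positivity) hε
  refine ⟨C, C', hC, hC', fun p hp G _ _ hG S hS hSt enc => ?_⟩
  obtain ⟨k, out, hrun, hbasis, hle⟩ := BasisAlgorithm.exists_run_isGroupBasis hp hG hS enc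
  exact ⟨k, out, hrun, hbasis, fun α hα =>
    ⟨hle.trans (hk p hp G hG S hS hSt α), hsqrt p hp G hG α hα⟩⟩
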